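/- For $n\in\mathbb N$ let $B_1^n=\{x\in\mathbb R^n : \sum_{i=1}^n|x_i|\le 1\}$ be the real $\ell_1^n$-ball, and for a Euclidean unit vector $a\in S^{n-1}\subset\mathbb R^n$ and $t\ge 0$ let $$A_1(a,t)=\mathrm{vol}_{n-1}\big(\{x\in B_1^n : \langle x,a\rangle=t\}\big).$$ Write $e_1,\dots,e_n$ for the standard unit vectors. (i) Let $n\ge 4$ and $\frac1{\sqrt3}\le t\le 1$. Then for all $a\in S^{n-1}$ $$A_1(a,t)\le A_1(e_1,t)=\frac{2^{n-1}}{(n-1)!}\,(1-t)^{n-1}.$$ The maximal hyperplane sections are parallel to coordinate hyperplanes: if moreover $t<1$, then $A_1(a,t)=A_1(e_1,t)$ holds if and only if $a=\pm e_j$ for some $j$. (ii) Let $n=3$, $0<t\le 1$ and $t_0=\sqrt2-1+\sqrt{5-\frac7{\sqrt2}}\approx 0.6384$. Then $A_1(e_1,t)=2(1-t)^2$, and the inequality $A_1(a,t)\le A_1(e_1,t)$ holds for all $a\in S^2$ if and only if $t\ge t_0$. If moreover $t_0<t<1$, then $A_1(a,t)=A_1(e_1,t)$ holds if and only if $a=\pm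 e_j$ for some $j$. -/

import Mathlib

open MeasureTheory
open scoped ENNReal

/-- The closed unit ball of `ℓ₁ⁿ` as a subset of Euclidean space `ℝⁿ`. -/
def l1Ball (n : ℕ) : Set (EuclideanSpace ℝ (Fin n)) :=
  {x | ∑ i, |x i| ≤ 1}

/-- The section `{x ∈ B₁ⁿ | ⟨x, a⟩ = t}` of the `ℓ₁ⁿ`-ball. -/
def l1Section {n : ℕ} (a : EuclideanSpace ℝ (Fin n)) (t : ℝ) :
    Set (EuclideanSpace ℝ (Fin n)) :=
  {x | x ∈ l1Ball n ∧ inner ℝ x a = t}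

/-- The parallel section function `A₁(a, t)` for a unit vector `a`: the `(n-1)`-dimensional volume
of `{x ∈ B₁ⁿ | ⟨x, a⟩ = t}`. The hyperplane `{x | ⟨x, a⟩ = t} = t a + a^⊥` is identified with the
`(n-1)`-dimensional Euclidean space `a^⊥` by the translation `y ↦ t a + y`; the measure is the
Lebesgue measure of the inner product space `a^⊥` (the unit cube spanned by an orthonormal basis
of `a^⊥` has measure one). -/
noncomputable def parallelSection {n : ℕ} (a : EuclideanSpace ℝ (Fin n)) (t : ℝ) : ℝ≥0∞ :=
  (measureSpaceOfInnerProductSpace (E := (ℝ ∙ a)ᗮ)).volume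
    {y : (ℝ ∙ a)ᗮ | t • a + (y : EuclideanSpace ℝ (Fin n)) ∈ l1Section a t}

/-- `a = ± e_j` for some standard unit vector `e_j`, that is, for a unit vector `a`, the hyperplanes
orthogonal to `a` are parallel to a coordinate hyperplane. -/
def IsCoordinateDirection {n : ℕ} (a : EuclideanSpace ℝ (Fin n)) : Prop :=
  ∃ j : Fin n, a = EuclideanSpace.single j 1 ∨ a = -EuclideanSpace.single j 1

/-! Signed permutations preserve the ball, so the coordinates of `a` may be taken nonnegative and
decreasing: `x = a 0 ≥ y = a 1 ≥ b`. Projecting the hyperplane along `e_0` and slicing in the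
direction of `e_1` turns the section into an integral of interval lengths. If all coordinates in `b`
are at most `t`, this yields the two-vertex formula `2 / (x² - y²) * (slabMass x - slabMass y)`
(`parallelSection_eq_slabMass`). For `t ≥ 1/√3` that case is the only one that matters, since three
coordinates above `t` would make the norm exceed one.

Up to a constant, `slabMass z` is the profile `(z - t)^(m+1) / z^m` times a product that decreases
in `z`. The product at `y` may therefore be replaced by the one at `x`, and a Weierstrass product
inequality bounds the latter by `∑ b²`, which the norm condition eliminates. What remains are
inequalities in `t, x, y` (`exists_bound_of_antitone`).

For `n ≥ 4`, raising the dimension by one costs a factor at most `1 - t` in the profile differences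
(`capProfile_sub_succ_le`), exactly the factor by which the target changes. Everything thus reduces
to `n = 4`, where the inequalities are strict away from coordinate directions.

For `n = 3` the competitor is the diagonal `(1,1,0)/√2`, with normalized value `(1 - 2t²)/√2`; its
comparison with `(1 - t)²` changes sign at `t₀` (`threshold_identity`). Below `t₀`, explicit
directions with vanishing third coordinate beat `e_1`. -/

/-! ### Hyperplane sections as volumes of coordinate projections. -/

theorem measurePreserving_smul_add_orthogonal {E : Type*} [NormedAddCommGroup E]
    [InnerProductSpace ℝ E] [FiniteDimensional ℝ E] [MeasurableSpace E] [BorelSpace E]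
    (a : E) (ha : ‖a‖ = 1) :
    MeasurePreserving (fun p : ℝ × (ℝ ∙ a)ᗮ => p.1 • a + (p.2 : E)) := by
  have h1 : MeasurePreserving (fun r : ℝ => LinearIsometryEquiv.toSpanUnitSingleton (𝕜 := ℝ) a ha r) :=
    LinearIsometryEquiv.measurePreserving _
  have h2 := (h1.prod (MeasurePreserving.id (volume : Measure (ℝ ∙ a)ᗮ)))
  have h3 := (WithLp.volume_preserving_toLp (U := (ℝ ∙ a)) (V := (ℝ ∙ a)ᗮ))
  have h4 := (ℝ ∙ a).orthogonalDecomposition.symm.measurePreserving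
  convert! h4.comp (h3.comp h2) using 1

theorem volume_Icc_affine {α β : ℝ} (hα : 0 < α) :
    volume {s : ℝ | α * s + β ∈ Set.Icc (0 : ℝ) 1} = ENNReal.ofReal (1 / α) := by
  have : {s : ℝ | α * s + β ∈ Set.Icc (0 : ℝ) 1} = Set.Icc (-β / α) ((1 - β) / α) := by
    ext s
    simp only [Set.mem_ofPred_eq, Set.mem_Icc, div_le_iff₀ hα, le_div_iff₀ hα]
    constructor <;> rintro ⟨h1, h2⟩ <;> constructor <;> linarith
  rw [this, Real.volume_Icc]
  congr 1
  field_simp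
  ring

theorem lintegral_euclideanSpace_succ {m : ℕ} {f : ℝ × (Fin m → ℝ) → ℝ≥0∞} (hf : Measurable f) :
    ∫⁻ x : EuclideanSpace ℝ (Fin (m + 1)), f (x 0, fun i => x i.succ)
      = ∫⁻ z : Fin m → ℝ, ∫⁻ s : ℝ, f (s, z) := by
  have h1 := PiLp.volume_preserving_ofLp (Fin (m + 1))
  have h2 := (volume_preserving_piFinSuccAbove (fun _ : Fin (m + 1) => ℝ) 0).comp h1
  have h3 := h2.lintegral_comp hf
  rw [Measure.volume_eq_prod, lintegral_prod_symm _ hf.aemeasurable] at h3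
  rw [← h3]
  rfl

/-- The slab `0 ≤ ⟨x, a⟩ ≤ 1` over `S` is measured twice by Fubini: along `a` all layers have the
same volume, and along `e_0` every fibre has length `1 / a 0`. -/
theorem volume_orthogonal_tail {m : ℕ} (a : EuclideanSpace ℝ (Fin (m + 1))) (ha : ‖a‖ = 1)
    (ha0 : 0 < a 0) (t : ℝ) {S : Set (Fin m → ℝ)} (hS : MeasurableSet S) :
    volume {y : (ℝ ∙ a)ᗮ | (fun i : Fin m =>
      (t • a + (y : EuclideanSpace ℝ (Fin (m + 1)))) i.succ) ∈ S} =
      ENNReal.ofReal (1 / a 0) * volume S := by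
  have hinner : ∀ v : EuclideanSpace ℝ (Fin (m + 1)), inner ℝ v a = a 0 * v 0 + ∑ i : Fin m, a i.succ * v i.succ := by
    intro v
    simp [PiLp.inner_apply, Fin.sum_univ_succ]
  have haa : inner ℝ a a = (1 : ℝ) := by rw [real_inner_self_eq_norm_sq, ha]; norm_num
  -- translation invariance
  have key : ∀ s : ℝ, volume {y : (ℝ ∙ a)ᗮ | (fun i : Fin m =>
      (s • a + (y : EuclideanSpace ℝ (Fin (m + 1)))) i.succ) ∈ S} =
      volume {y : (ℝ ∙ a)ᗮ | (fun i : Fin m =>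
      ((y : EuclideanSpace ℝ (Fin (m + 1)))) i.succ) ∈ S} := by
    intro s
    -- This vector of `a^⊥` differs from `s • a` only in coordinate `0`, which the projection
    -- forgets.
    let v : EuclideanSpace ℝ (Fin (m + 1)) := s • a - (s / a 0) • EuclideanSpace.single 0 1
    have hv : v ∈ (ℝ ∙ a)ᗮ := by
      rw [Submodule.mem_orthogonal_singleton_iff_inner_left]
      simp only [v, inner_sub_left, inner_smul_left, haa, EuclideanSpace.inner_single_left]
      simp [ha0.ne']
    rw [← measure_preimage_add (volume : Measure (ℝ ∙ a)ᗮ) (⟨v, hv⟩)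
      {y : (ℝ ∙ a)ᗮ | (fun i : Fin m =>
      ((y : EuclideanSpace ℝ (Fin (m + 1)))) i.succ) ∈ S}]
    congr 1
    ext y
    simp [v]
  set V := volume {y : (ℝ ∙ a)ᗮ | (fun i : Fin m =>
      ((y : EuclideanSpace ℝ (Fin (m + 1)))) i.succ) ∈ S} with hV
  rw [key]
  let f : ℝ × (Fin m → ℝ) → ℝ≥0∞ := Set.indicator
    {p | a 0 * p.1 + ∑ i : Fin m, a i.succ * p.2 i ∈ Set.Icc (0 : ℝ) 1 ∧ p.2 ∈ S} 1
  have hms : MeasurableSet {p : ℝ × (Fin m → ℝ) | a 0 * p.1 + ∑ i : Fin m, a i.succ * p.2 i ∈ Set.Icc (0 : ℝ) 1 ∧ p.2 ∈ S} := by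
    apply MeasurableSet.inter
    · exact measurableSet_Icc.preimage (by fun_prop)
    · exact hS.preimage measurable_snd
  have hf : Measurable f := measurable_one.indicator hms
  have e1 := lintegral_euclideanSpace_succ hf
  have hg : Measurable (fun x : EuclideanSpace ℝ (Fin (m + 1)) => f (x 0, fun i => x i.succ)) := by
    apply hf.comp
    fun_prop
  have e2 := (measurePreserving_smul_add_orthogonal a ha).lintegral_comp hg
  rw [Measure.volume_eq_prod, lintegral_prod
    (fun p : ℝ × (ℝ ∙ a)ᗮ => f ((p.1 • a + (p.2 : EuclideanSpace ℝ (Fin (m + 1)))) 0,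
      fun i => (p.1 • a + (p.2 : EuclideanSpace ℝ (Fin (m + 1)))) i.succ))
    (hg.comp (measurePreserving_smul_add_orthogonal a ha).measurable).aemeasurable] at e2
  rw [e1] at e2
  have l1 : ∀ s : ℝ, ∫⁻ y : (ℝ ∙ a)ᗮ, f ((s • a + (y : EuclideanSpace ℝ (Fin (m + 1)))) 0, fun i => (s • a + (y : EuclideanSpace ℝ (Fin (m + 1)))) i.succ)
      = Set.indicator (Set.Icc (0 : ℝ) 1) (fun _ => V) s := by
    intro s
    have hy : ∀ y : (ℝ ∙ a)ᗮ, a 0 * (s • a + (y : EuclideanSpace ℝ (Fin (m + 1)))) 0 + ∑ i : Fin m, a i.succ * (s • a + (y : EuclideanSpace ℝ (Fin (m + 1)))) i.succ = s := by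
      intro y
      rw [← hinner, inner_add_left, inner_smul_left, haa,
        Submodule.mem_orthogonal_singleton_iff_inner_left.1 y.2]
      simp
    by_cases hs : s ∈ Set.Icc (0 : ℝ) 1
    · rw [Set.indicator_of_mem hs, ← key s, ← lintegral_indicator_one]
      · congr 1
        funext y
        have hy' := hy y
        simp only [f, Set.indicator, Set.mem_ofPred_eq, Pi.one_apply]
        by_cases hyS : (fun i => (s • a + (y : EuclideanSpace ℝ (Fin (m + 1)))) i.succ) ∈ S
        · rw [if_pos ⟨hy'.symm ▸ hs, hyS⟩, if_pos hyS]
        · rw [if_neg fun h => hyS h.2, if_neg hyS]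
      · exact hS.preimage (by fun_prop)
    · rw [Set.indicator_of_notMem hs]
      simp only [f, Set.indicator, Set.mem_ofPred_eq, hy, hs, false_and]
      simp
  have l2 : ∀ z : Fin m → ℝ, ∫⁻ s : ℝ, f (s, z) = S.indicator (fun _ => ENNReal.ofReal (1 / a 0)) z := by
    intro z
    by_cases hz : z ∈ S
    · rw [Set.indicator_of_mem hz, ← volume_Icc_affine ha0 (β := ∑ i : Fin m, a i.succ * z i), ← lintegral_indicator_one]
      · congr 1
        funext s
        simp only [f, Set.indicator, Set.mem_ofPred_eq, hz, and_true, Pi.one_apply]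
      · exact measurableSet_Icc.preimage (by fun_prop)
    · rw [Set.indicator_of_notMem hz]
      simp only [f, Set.indicator, Set.mem_ofPred_eq, hz, and_false]
      simp
  simp only [l1, l2] at e2
  rw [lintegral_indicator measurableSet_Icc, lintegral_indicator hS] at e2
  simpa using e2

theorem parallelSection_eq_volume_pi {m : ℕ} (a : EuclideanSpace ℝ (Fin (m + 1))) (ha : ‖a‖ = 1)
    (ha0 : 0 < a 0) (t : ℝ) :
    parallelSection a t = ENNReal.ofReal (1 / a 0) *
      volume {z : Fin m → ℝ |
        |t - ∑ i, a i.succ * z i| + a 0 * ∑ i, |z i| ≤ a 0} := by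
  have hm : MeasurableSet {z : Fin m → ℝ |
        |t - ∑ i, a i.succ * z i| + a 0 * ∑ i, |z i| ≤ a 0} :=
    (isClosed_le (by fun_prop) (by fun_prop)).measurableSet
  rw [← volume_orthogonal_tail a ha ha0 t hm]
  unfold parallelSection
  congr 1
  ext y
  have haa : inner ℝ a a = (1 : ℝ) := by rw [real_inner_self_eq_norm_sq, ha]; norm_num
  have hin : inner ℝ (t • a + (y : EuclideanSpace ℝ (Fin (m + 1)))) a = t := by
    rw [inner_add_left, inner_smul_left, haa,
        Submodule.mem_orthogonal_singleton_iff_inner_left.1 y.2]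
    simp
  simp only [l1Section, l1Ball, Set.mem_ofPred_eq, hin, and_true]
  generalize t • a + (y : EuclideanSpace ℝ (Fin (m + 1))) = v at hin ⊢
  have hv : inner ℝ v a = a 0 * v 0 + ∑ i : Fin m, a i.succ * v i.succ := by
    simp [PiLp.inner_apply, Fin.sum_univ_succ]
  rw [hin] at hv
  rw [Fin.sum_univ_succ]
  have : t - ∑ i : Fin m, a i.succ * v i.succ = a 0 * v 0 := by linarith
  rw [this, abs_mul, abs_of_pos ha0, ← mul_add]
  exact ⟨fun h => by nlinarith, fun h => le_of_mul_le_mul_left (by linarith) ha0⟩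

/-! ### Elementary integrals and interval lengths. -/

theorem lintegral_Ioi_max_sub_mul_pow {s c : ℝ} (hc : 0 < c) (k : ℕ) :
    ∫⁻ u in Set.Ioi (0 : ℝ), ENNReal.ofReal ((max (s - c * u) 0) ^ (k + 1)) =
      ENNReal.ofReal ((max s 0) ^ (k + 2) / (k + 2) * (1 / c)) := by
  rcases le_or_gt s 0 with hs | hs
  · rw [max_eq_right hs]
    rw [setLIntegral_congr_fun (g := fun _ => 0) measurableSet_Ioi]
    · simp
    · intro u hu
      have hu' : 0 < u := hu
      have : s - c * u ≤ 0 := by nlinarith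
      simp [max_eq_right this]
  · rw [max_eq_left hs.le]
    have h1 : ∫⁻ u in Set.Ioi (0 : ℝ), ENNReal.ofReal ((max (s - c * u) 0) ^ (k + 1)) =
        ∫⁻ u in Set.Ioc (0 : ℝ) (s / c), ENNReal.ofReal ((s - c * u) ^ (k + 1)) := by
      rw [← lintegral_indicator measurableSet_Ioi, ← lintegral_indicator measurableSet_Ioc]
      congr 1
      funext u
      by_cases hu : 0 < u
      · by_cases hu2 : u ≤ s / c
        · have : 0 ≤ s - c * u := by rw [le_div_iff₀ hc] at hu2; linarith
          simp [Set.indicator, hu, hu2, max_eq_left this]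
        · have : s - c * u ≤ 0 := by rw [not_le, div_lt_iff₀ hc] at hu2; linarith
          simp [Set.indicator, hu, hu2, max_eq_right this]
      · simp [Set.indicator, hu]
    have hsc : 0 ≤ s / c := by positivity
    rw [h1, ← ofReal_integral_eq_lintegral_ofReal]
    · rw [← intervalIntegral.integral_of_le hsc,
        intervalIntegral.integral_comp_sub_mul (fun v => v ^ (k + 1)) hc.ne', integral_pow]
      congr 1
      have : s - c * (s / c) = 0 := by field_simp; ring
      rw [this]
      simp
      field_simp
      ring
    · exact (Continuous.integrableOn_Icc (by fun_prop)).mono_set Set.Ioc_subset_Icc_self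
    · rw [Filter.EventuallyLE, ae_restrict_iff' measurableSet_Ioc]
      refine Filter.Eventually.of_forall fun u hu => ?_
      have : 0 ≤ s - c * u := by have := hu.2; rw [le_div_iff₀ hc] at this; linarith
      exact pow_nonneg this _

/-- The two half-lines have slopes `x - b` and `x + b`, and `1/(x - b) + 1/(x + b) = 2x/(x² - b²)`.
-/
theorem lintegral_max_sub_abs_pow {s x b : ℝ} (hb : |b| < x) (k : ℕ) :
    ∫⁻ u : ℝ, ENNReal.ofReal ((max (s - (x * |u| - b * u)) 0) ^ (k + 1)) =
      ENNReal.ofReal ((max s 0) ^ (k + 2) / (k + 2) * (2 * x / (x ^ 2 - b ^ 2))) := by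
  obtain ⟨hb1, hb2⟩ := abs_lt.1 hb
  rw [← setLIntegral_univ, ← Set.Iic_union_Ioi (a := (0 : ℝ)),
    lintegral_union measurableSet_Ioi (Set.Iic_disjoint_Ioi le_rfl)]
  have h1 : ∫⁻ u in Set.Ioi (0 : ℝ), ENNReal.ofReal ((max (s - (x * |u| - b * u)) 0) ^ (k + 1)) =
      ∫⁻ u in Set.Ioi (0 : ℝ), ENNReal.ofReal ((max (s - (x - b) * u) 0) ^ (k + 1)) := by
    refine setLIntegral_congr_fun measurableSet_Ioi fun u hu => ?_
    simp only [abs_of_pos (show 0 < u from hu), sub_mul]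
  have h2 : ∫⁻ u in Set.Iic (0 : ℝ), ENNReal.ofReal ((max (s - (x * |u| - b * u)) 0) ^ (k + 1)) =
      ∫⁻ u in Set.Ioi (0 : ℝ), ENNReal.ofReal ((max (s - (x + b) * u) 0) ^ (k + 1)) := by
    rw [setLIntegral_congr (Iio_ae_eq_Iic (a := (0 : ℝ))).symm]
    have := (Measure.measurePreserving_neg (volume : Measure ℝ)).setLIntegral_comp_preimage
      (measurableSet_Iio (a := (0 : ℝ)))
      (f := fun u => ENNReal.ofReal ((max (s - (x * |u| - b * u)) 0) ^ (k + 1))) (by fun_prop)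
    rw [← this]
    have hpre : Neg.neg ⁻¹' Set.Iio (0 : ℝ) = Set.Ioi 0 := by ext; simp
    rw [hpre]
    refine setLIntegral_congr_fun measurableSet_Ioi fun u hu => ?_
    simp only [abs_neg, abs_of_pos (show 0 < u from hu)]
    ring_nf
  rw [h1, h2, lintegral_Ioi_max_sub_mul_pow (by linarith), lintegral_Ioi_max_sub_mul_pow (by linarith),
    ← ENNReal.ofReal_add]
  · congr 1
    have e1 : x + b ≠ 0 := by linarith
    have e2 : x - b ≠ 0 := by linarith
    have e3 : x ^ 2 - b ^ 2 = (x + b) * (x - b) := by ring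
    rw [e3]
    field_simp
    ring
  · have : 0 < x + b := by linarith
    positivity
  · have : 0 < x - b := by linarith
    positivity

theorem lintegral_max_sub_sum_abs_pow {m : ℕ} (x : ℝ) (b : Fin m → ℝ) (hb : ∀ i, |b i| < x) (s : ℝ)
    (k : ℕ) :
    ∫⁻ w : Fin m → ℝ, ENNReal.ofReal ((max (s - ∑ i, (x * |w i| - b i * w i)) 0) ^ (k + 1)) =
      ENNReal.ofReal ((max s 0) ^ (k + 1 + m) * (((k + 1).factorial : ℝ) / (k + 1 + m).factorial) *
        ∏ i, (2 * x / (x ^ 2 - b i ^ 2))) := by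
  induction m generalizing s with
  | zero =>
    have : ((k + 1).factorial : ℝ) ≠ 0 := by positivity
    rw [lintegral_unique]
    simp [this]
    rw [show (volume : Measure (Fin 0 → ℝ)) Set.univ = 1 by simp [volume_pi]]
    simp
  | succ m ih =>
    have hC : 0 ≤ ∏ i : Fin m, (2 * x / (x ^ 2 - b i.succ ^ 2)) := by
      refine Finset.prod_nonneg fun i _ => ?_
      have h := hb i.succ
      have h0 := abs_nonneg (b i.succ)
      have := sq_lt_sq' (by linarith) h
      rw [sq_abs] at this
      exact div_nonneg (by linarith) (by linarith)
    have h2 := (volume_preserving_piFinSuccAbove (fun _ : Fin (m + 1) => ℝ) 0)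
    have h3 := h2.lintegral_comp (f := fun p : ℝ × (Fin m → ℝ) => ENNReal.ofReal
      ((max ((s - (x * |p.1| - b 0 * p.1)) - ∑ i : Fin m, (x * |p.2 i| - b i.succ * p.2 i)) 0) ^ (k + 1)))
      (by fun_prop)
    rw [Measure.volume_eq_prod, lintegral_prod _ (by fun_prop)] at h3
    have h4 : ∀ w : Fin (m + 1) → ℝ, s - ∑ i, (x * |w i| - b i * w i) =
      (s - (x * |w 0| - b 0 * w 0)) - ∑ i : Fin m, (x * |w i.succ| - b i.succ * w i.succ) := by
      intro w
      rw [Fin.sum_univ_succ]; ring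
    simp only [h4]
    refine h3.trans ?_
    simp only [ih (fun i => b i.succ) (fun i => hb i.succ)]
    have h5 : ∀ u : ℝ, ENNReal.ofReal ((max (s - (x * |u| - b 0 * u)) 0) ^ (k + 1 + m) *
        (((k + 1).factorial : ℝ) / (k + 1 + m).factorial) *
        ∏ i : Fin m, (2 * x / (x ^ 2 - b i.succ ^ 2))) =
        ENNReal.ofReal ((((k + 1).factorial : ℝ) / (k + 1 + m).factorial) *
        ∏ i : Fin m, (2 * x / (x ^ 2 - b i.succ ^ 2))) *
        ENNReal.ofReal ((max (s - (x * |u| - b 0 * u)) 0) ^ (k + m + 1)) := by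
      intro u
      rw [← ENNReal.ofReal_mul (by positivity)]
      congr 1
      rw [show k + 1 + m = k + m + 1 by ring]
      ring
    simp only [h5]
    rw [lintegral_const_mul _ (by fun_prop), lintegral_max_sub_abs_pow (hb 0),
      ← ENNReal.ofReal_mul (by positivity), Fin.prod_univ_succ]
    congr 1
    have e1 : ((k + 1 + (m + 1)).factorial : ℝ) = (k + m + 2) * (k + 1 + m).factorial := by
      rw [show k + 1 + (m + 1) = (k + 1 + m) + 1 by ring, Nat.factorial_succ]
      push_cast; ring
    rw [e1, show k + 1 + (m + 1) = k + m + 2 by ring]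
    have e2 : ((k : ℝ) + m + 2) ≠ 0 := by positivity
    push_cast
    field_simp

/-- The set is an interval whose right end is determined with `τ - y z` nonnegative or nonpositive
there, according to the sign of `y ρ - τ`; the second positive part records the switch. -/
theorem volume_abs_sub_add_abs_le {x y ρ τ : ℝ} (hy : 0 ≤ y) (hxy : y < x) (hτ : 0 ≤ τ) :
    volume {z : ℝ | |τ - y * z| + x * |z| ≤ x * ρ} =
      ENNReal.ofReal (2 * x / (x ^ 2 - y ^ 2) * (max (x * ρ - τ) 0 - max (y * ρ - τ) 0)) := by
  have hx : 0 < x := by linarith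
  rcases lt_or_ge (x * ρ) τ with h | h
  · have he : {z : ℝ | |τ - y * z| + x * |z| ≤ x * ρ} = ∅ := by
      ext z
      simp only [Set.mem_ofPred_eq, Set.mem_empty_iff_false, iff_false, not_le]
      have h1 := le_abs_self (τ - y * z)
      have h2 := le_abs_self z
      have h3 := abs_nonneg z
      nlinarith
    have h2 : y * ρ - τ ≤ 0 := by
      rcases le_or_gt 0 ρ with h0 | h0 <;> nlinarith
    rw [he, max_eq_right h2, max_eq_right (by linarith)]
    simp
  · have hρ : 0 ≤ ρ := by
      by_contra hc
      nlinarith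
    have he : {z : ℝ | |τ - y * z| + x * |z| ≤ x * ρ} =
        Set.Icc (-((x * ρ - τ) / (x + y))) (min ((x * ρ - τ) / (x - y)) ((x * ρ + τ) / (x + y))) := by
      have p1 : 0 < x + y := by linarith
      have p2 : 0 < x - y := by linarith
      ext z
      simp only [Set.mem_ofPred_eq, Set.mem_Icc, le_min_iff, le_div_iff₀ p1, le_div_iff₀ p2, ← neg_div,
        div_le_iff₀ p1]
      constructor
      · intro hz
        have h1 := le_abs_self (τ - y * z)
        have h2 := neg_le_abs (τ - y * z)
        have h3 := le_abs_self z
        have h4 := neg_le_abs z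
        refine ⟨?_, ?_, ?_⟩ <;> nlinarith
      · rintro ⟨h1, h2, h3⟩
        rcases abs_cases (τ - y * z) with h | h <;> rcases abs_cases z with h' | h' <;> rw [h.1, h'.1] <;> nlinarith
    rw [he, Real.volume_Icc, max_eq_left (by linarith)]
    congr 1
    have p1 : 0 < x + y := by linarith
    have p2 : 0 < x - y := by linarith
    have e3 : x ^ 2 - y ^ 2 = (x + y) * (x - y) := by ring
    rcases le_total (y * ρ) τ with h' | h'
    · rw [max_eq_right (by linarith), min_eq_left, e3]
      · field_simp; ring
      · rw [div_le_div_iff₀ p2 p1]; nlinarith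
    · rw [max_eq_left (by linarith), min_eq_right, e3]
      · field_simp; ring
      · rw [div_le_div_iff₀ p1 p2]; nlinarith

/-- Substitute for the previous formula when the two slopes coincide: a nonempty set lies in an
interval of length `ρ`, which is the divided difference of `z ↦ z ρ - τ`. The free parameter `x'`
later tends to `x`. -/
theorem volume_abs_sub_add_abs_le_of_eq {x x' ρ τ : ℝ} (hx : 0 < x) (hxx : x < x') (hτ : 0 ≤ τ) :
    volume {z : ℝ | |τ - x * z| + x * |z| ≤ x * ρ} ≤
      ENNReal.ofReal (1 / (x' - x) * (max (x' * ρ - τ) 0 - max (x * ρ - τ) 0)) := by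
  rcases lt_or_ge (x * ρ) τ with h | h
  · have he : {z : ℝ | |τ - x * z| + x * |z| ≤ x * ρ} = ∅ := by
      ext z
      simp only [Set.mem_ofPred_eq, Set.mem_empty_iff_false, iff_false, not_le]
      have h1 := le_abs_self (τ - x * z)
      have h2 := le_abs_self z
      have h3 := abs_nonneg z
      nlinarith
    rw [he]
    simp
  · have hρ : 0 ≤ ρ := by
      by_contra hc
      nlinarith
    have h2 : 0 ≤ x' * ρ - τ := by nlinarith
    rw [max_eq_left h2, max_eq_left (by linarith)]
    have : 1 / (x' - x) * (x' * ρ - τ - (x * ρ - τ)) = ρ := by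
      have : x' - x ≠ 0 := by linarith
      field_simp
      ring
    rw [this]
    have hs : {z : ℝ | |τ - x * z| + x * |z| ≤ x * ρ} ⊆
        Set.Icc (-((x * ρ - τ) / (2 * x))) ((x * ρ + τ) / (2 * x)) := by
      intro z hz
      simp only [Set.mem_ofPred_eq] at hz
      have p : 0 < 2 * x := by linarith
      rw [Set.mem_Icc, le_div_iff₀ p, ← neg_div, div_le_iff₀ p]
      have h1 := le_abs_self (τ - x * z)
      have h2 := neg_le_abs (τ - x * z)
      have h3 := le_abs_self z
      have h4 := neg_le_abs z
      refine ⟨?_, ?_⟩ <;> nlinarith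
    refine (measure_mono hs).trans ?_
    rw [Real.volume_Icc]
    apply le_of_eq
    congr 1
    field_simp
    ring

/-! ### The two-vertex formula for the section volume. -/

/-- The integrand `z * (1 - ∑ |wᵢ|) - (t - ∑ bᵢ wᵢ)`. -/
def slabGap {m : ℕ} (b : Fin m → ℝ) (t z : ℝ) (w : Fin m → ℝ) : ℝ :=
  z - t - ∑ i, (z * |w i| - b i * w i)

/-- The integral of the positive part of `slabGap`. -/
noncomputable def slabMass {m : ℕ} (b : Fin m → ℝ) (t z : ℝ) : ℝ :=
  (max (z - t) 0) ^ (m + 1) / (m + 1).factorial * ∏ i, (2 * z / (z ^ 2 - b i ^ 2))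

section
variable {m : ℕ} {b : Fin m → ℝ} {t x y z : ℝ}

theorem slabGap_eq (b : Fin m → ℝ) (t z : ℝ) (w : Fin m → ℝ) :
    slabGap b t z w = z * (1 - ∑ i, |w i|) - (t - ∑ i, b i * w i) := by
  unfold slabGap
  rw [Finset.sum_sub_distrib, ← Finset.mul_sum]
  ring

theorem continuous_slabGap (b : Fin m → ℝ) (t z : ℝ) : Continuous (slabGap b t z) := by
  unfold slabGap
  fun_prop

theorem sum_mul_abs_sub_nonneg (hb : ∀ i, |b i| ≤ z) (w : Fin m → ℝ) :
    0 ≤ ∑ i, (z * |w i| - b i * w i) := by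
  refine Finset.sum_nonneg fun i _ => ?_
  have h1 := le_abs_self (b i * w i)
  rw [abs_mul] at h1
  nlinarith [abs_nonneg (w i), hb i]

theorem slabGap_nonpos (hbz : ∀ i, |b i| ≤ z) (hbt : ∀ i, |b i| ≤ t) {w : Fin m → ℝ}
    (hw : z ≤ t ∨ 1 - ∑ i, |w i| ≤ 0) : slabGap b t z w ≤ 0 := by
  rcases le_or_gt z t with h | h
  · have := sum_mul_abs_sub_nonneg hbz w
    unfold slabGap
    linarith
  · have h1 := sum_mul_abs_sub_nonneg hbt w
    rw [Finset.sum_sub_distrib, ← Finset.mul_sum] at h1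
    rw [slabGap_eq]
    have := hw.resolve_left (not_le.2 h)
    nlinarith

theorem sub_sum_nonneg (ht : 0 ≤ t) (hbt : ∀ i, |b i| ≤ t) {w : Fin m → ℝ}
    (hw : 0 ≤ 1 - ∑ i, |w i|) : 0 ≤ t - ∑ i, b i * w i := by
  have h1 := sum_mul_abs_sub_nonneg hbt w
  rw [Finset.sum_sub_distrib, ← Finset.mul_sum] at h1
  nlinarith

/-- For `z ≤ t` both sides vanish; for `z > t` the bound `|b i| ≤ t` gives the strict inequality `|b
i| < z` needed for convergence. -/
theorem lintegral_max_slabGap (hbz : ∀ i, |b i| ≤ z) (hbt : ∀ i, |b i| ≤ t) :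
    ∫⁻ w, ENNReal.ofReal (max (slabGap b t z w) 0) = ENNReal.ofReal (slabMass b t z) := by
  rcases le_or_gt z t with h | h
  · have : ∀ w, max (slabGap b t z w) 0 = 0 := fun w => max_eq_right (slabGap_nonpos hbz hbt (Or.inl h))
    simp [this, slabMass, max_eq_right (sub_nonpos.2 h)]
  · have := lintegral_max_sub_sum_abs_pow z b (fun i => (hbt i).trans_lt h) (z - t) 0
    simp only [zero_add, pow_one] at this
    refine this.trans ?_
    unfold slabMass
    congr 1
    rw [Nat.factorial_one, add_comm 1 m]
    push_cast
    ring

theorem slabMass_nonneg (hbz : ∀ i, |b i| ≤ z) (hz : 0 ≤ z) : 0 ≤ slabMass b t z := by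
  unfold slabMass
  refine mul_nonneg (by positivity) (Finset.prod_nonneg fun i _ => div_nonneg (by linarith) ?_)
  have := sq_le_sq' (by linarith [abs_nonneg (b i), hbz i]) (hbz i)
  rw [sq_abs] at this
  linarith

theorem max_slabGap_mono (hby : ∀ i, |b i| ≤ y) (hbt : ∀ i, |b i| ≤ t) (hxy : y ≤ x) (w : Fin m → ℝ) :
    max (slabGap b t y w) 0 ≤ max (slabGap b t x w) 0 := by
  rcases le_or_gt (1 - ∑ i, |w i|) 0 with h | h
  · rw [max_eq_right (slabGap_nonpos hby hbt (Or.inr h))]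
    exact le_max_right _ _
  · refine max_le_max_right _ ?_
    rw [slabGap_eq, slabGap_eq]
    nlinarith

theorem lintegral_max_slabGap_sub (hy : 0 ≤ y) (hby : ∀ i, |b i| ≤ y) (hbt : ∀ i, |b i| ≤ t)
    (hxy : y ≤ x) :
    ∫⁻ w, ENNReal.ofReal (max (slabGap b t x w) 0 - max (slabGap b t y w) 0) =
      ENNReal.ofReal (slabMass b t x - slabMass b t y) := by
  have hbx : ∀ i, |b i| ≤ x := fun i => (hby i).trans hxy
  have hc := continuous_slabGap b t
  have hmx := (hc x).measurable
  have hmy := (hc y).measurable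
  simp only [fun w => ENNReal.ofReal_sub (max (slabGap b t x w) 0) (le_max_right (slabGap b t y w) 0)]
  rw [lintegral_sub (by fun_prop), lintegral_max_slabGap hbx hbt, lintegral_max_slabGap hby hbt,
    ENNReal.ofReal_sub _ (slabMass_nonneg hby hy)]
  · rw [lintegral_max_slabGap hby hbt]
    exact ENNReal.ofReal_ne_top
  · exact Filter.Eventually.of_forall fun w => ENNReal.ofReal_le_ofReal (max_slabGap_mono hby hbt hxy w)

end

theorem parallelSection_eq_lintegral {m : ℕ} (a : EuclideanSpace ℝ (Fin (m + 2))) (ha : ‖a‖ = 1)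
    (ha0 : 0 < a 0) (t : ℝ) :
    parallelSection a t = ENNReal.ofReal (1 / a 0) * ∫⁻ w : Fin m → ℝ,
      volume {z : ℝ | |(t - ∑ i, a i.succ.succ * w i) - a 1 * z| + a 0 * |z| ≤
        a 0 * (1 - ∑ i, |w i|)} := by
  rw [parallelSection_eq_volume_pi a ha ha0]
  congr 1
  have hms : MeasurableSet {p : ℝ × (Fin m → ℝ) |
      |(t - ∑ i, a i.succ.succ * p.2 i) - a 1 * p.1| + a 0 * |p.1| ≤ a 0 * (1 - ∑ i, |p.2 i|)} :=
    (isClosed_le (by fun_prop) (by fun_prop)).measurableSet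
  have h2 := (volume_preserving_piFinSuccAbove (fun _ : Fin (m + 1) => ℝ) 0)
  have h3 := h2.measure_preimage hms.nullMeasurableSet
  rw [Measure.volume_eq_prod, Measure.prod_apply_symm hms] at h3
  refine Eq.trans ?_ h3
  congr 1
  ext w
  simp only [Set.mem_ofPred_eq, Set.mem_preimage, Fin.sum_univ_succ (n := m)]
  change _ ↔ |(t - ∑ i : Fin m, a i.succ.succ * w i.succ) - a 1 * w 0| + a 0 * |w 0| ≤
    a 0 * (1 - ∑ i : Fin m, |w i.succ|)
  have e : (Fin.succ 0 : Fin (m + 2)) = 1 := rfl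
  rw [e]
  have : t - (a 1 * w 0 + ∑ i : Fin m, a i.succ.succ * w i.succ) =
    (t - ∑ i : Fin m, a i.succ.succ * w i.succ) - a 1 * w 0 := by ring
  rw [this]
  constructor <;> intro h <;> linarith

theorem volume_empty_of_neg {x y ρ τ : ℝ} (hx : 0 < x) (hρ : ρ < 0) :
    volume {z : ℝ | |τ - y * z| + x * |z| ≤ x * ρ} = 0 := by
  have he : {z : ℝ | |τ - y * z| + x * |z| ≤ x * ρ} = ∅ := by
    ext z
    simp only [Set.mem_ofPred_eq, Set.mem_empty_iff_false, iff_false, not_le]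
    have h1 := abs_nonneg (τ - y * z)
    have h3 := abs_nonneg z
    nlinarith
  rw [he, measure_empty]

/-- The terms at `a 0` and `a 1` are the contributions of the vertices `e_0` and `e_1`; vertices at
height at most `t` contribute nothing. -/
theorem parallelSection_eq_slabMass {m : ℕ} (a : EuclideanSpace ℝ (Fin (m + 2))) (ha : ‖a‖ = 1)
    (h1 : 0 ≤ a 1) (h01 : a 1 < a 0) {t : ℝ} (ht : 0 ≤ t) (hb1 : ∀ i : Fin m, |a i.succ.succ| ≤ a 1)
    (hbt : ∀ i : Fin m, |a i.succ.succ| ≤ t) :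
    parallelSection a t = ENNReal.ofReal (2 / (a 0 ^ 2 - a 1 ^ 2) *
      (slabMass (fun i : Fin m => a i.succ.succ) t (a 0) -
        slabMass (fun i : Fin m => a i.succ.succ) t (a 1))) := by
  have h0 : 0 < a 0 := by linarith
  rw [parallelSection_eq_lintegral a ha h0]
  set b : Fin m → ℝ := fun i => a i.succ.succ with hb
  have hsq : 0 < a 0 ^ 2 - a 1 ^ 2 := by nlinarith
  have key : ∀ w : Fin m → ℝ, volume {z : ℝ | |(t - ∑ i, a i.succ.succ * w i) - a 1 * z| + a 0 * |z| ≤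
        a 0 * (1 - ∑ i, |w i|)} = ENNReal.ofReal (2 * a 0 / (a 0 ^ 2 - a 1 ^ 2)) *
        ENNReal.ofReal (max (slabGap b t (a 0) w) 0 - max (slabGap b t (a 1) w) 0) := by
    intro w
    rw [← ENNReal.ofReal_mul (by positivity)]
    rcases lt_or_ge (1 - ∑ i, |w i|) 0 with h | h
    · rw [volume_empty_of_neg h0 h, max_eq_right (slabGap_nonpos (fun i => (hb1 i).trans h01.le) hbt (Or.inr h.le)),
        max_eq_right (slabGap_nonpos hb1 hbt (Or.inr h.le))]
      simp
    · rw [volume_abs_sub_add_abs_le h1 h01 (sub_sum_nonneg ht hbt h), slabGap_eq, slabGap_eq]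
  simp only [key]
  rw [lintegral_const_mul' _ _ ENNReal.ofReal_ne_top, lintegral_max_slabGap_sub h1 hb1 hbt h01.le,
    ← ENNReal.ofReal_mul (by positivity), ← ENNReal.ofReal_mul (by positivity)]
  congr 1
  field_simp
  rfl

theorem parallelSection_le_slabMass {m : ℕ} (a : EuclideanSpace ℝ (Fin (m + 2))) (ha : ‖a‖ = 1)
    (h0 : 0 < a 0) (h01 : a 1 = a 0) {t : ℝ} (ht : 0 ≤ t) (hb1 : ∀ i : Fin m, |a i.succ.succ| ≤ a 0)
    (hbt : ∀ i : Fin m, |a i.succ.succ| ≤ t) {x' : ℝ} (hx' : a 0 < x') :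
    parallelSection a t ≤ ENNReal.ofReal (1 / (a 0 * (x' - a 0)) *
      (slabMass (fun i : Fin m => a i.succ.succ) t x' -
        slabMass (fun i : Fin m => a i.succ.succ) t (a 0))) := by
  rw [parallelSection_eq_lintegral a ha h0]
  set b : Fin m → ℝ := fun i => a i.succ.succ with hb
  have hsq : 0 < x' - a 0 := by linarith
  have key : ∀ w : Fin m → ℝ, volume {z : ℝ | |(t - ∑ i, a i.succ.succ * w i) - a 1 * z| + a 0 * |z| ≤
        a 0 * (1 - ∑ i, |w i|)} ≤ ENNReal.ofReal (1 / (x' - a 0)) *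
        ENNReal.ofReal (max (slabGap b t x' w) 0 - max (slabGap b t (a 0) w) 0) := by
    intro w
    rw [← ENNReal.ofReal_mul (by positivity), h01]
    rcases lt_or_ge (1 - ∑ i, |w i|) 0 with h | h
    · rw [volume_empty_of_neg h0 h]
      exact zero_le
    · rw [slabGap_eq, slabGap_eq]
      exact volume_abs_sub_add_abs_le_of_eq h0 hx' (sub_sum_nonneg ht hbt h)
  refine (mul_le_mul_right (lintegral_mono key) _).trans ?_
  rw [lintegral_const_mul' _ _ ENNReal.ofReal_ne_top, lintegral_max_slabGap_sub h0.le hb1 hbt hx'.le,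
    ← ENNReal.ofReal_mul (by positivity), ← ENNReal.ofReal_mul (by positivity)]
  apply le_of_eq
  congr 1
  field_simp
  rfl

/-! ### Symmetries, coordinate directions and null sections. -/

theorem parallelSection_map {n : ℕ} (g : EuclideanSpace ℝ (Fin n) ≃ₗᵢ[ℝ] EuclideanSpace ℝ (Fin n))
    (hg : ∀ x, g x ∈ l1Ball n ↔ x ∈ l1Ball n) (a : EuclideanSpace ℝ (Fin n)) (t : ℝ) :
    parallelSection (g a) t = parallelSection a t := by
  have hmap : (ℝ ∙ a)ᗮ.map (g.toLinearEquiv : _ →ₗ[ℝ] _) = (ℝ ∙ g a)ᗮ := by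
    have := Submodule.map_orthogonal_equiv (ℝ ∙ a) g
    rw [Submodule.map_span, Set.image_singleton] at this
    exact this
  let f : (ℝ ∙ a)ᗮ ≃ₗᵢ[ℝ] (ℝ ∙ g a)ᗮ :=
    (LinearIsometryEquiv.submoduleMap (ℝ ∙ a)ᗮ g).trans (LinearIsometryEquiv.ofEq _ _ hmap)
  have hf : ∀ y, (f y : EuclideanSpace ℝ (Fin n)) = g y := fun y => rfl
  have h := f.measurePreserving.measure_preimage_equiv (f := f.toMeasurableEquiv)
    {y : (ℝ ∙ g a)ᗮ | t • g a + (y : EuclideanSpace ℝ (Fin n)) ∈ l1Section (g a) t}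
  unfold parallelSection
  rw [← h]
  congr 1
  ext y
  have e : t • g a + (f y : EuclideanSpace ℝ (Fin n)) = g (t • a + y) := by
    rw [hf, map_add, map_smul]
  simp only [Set.mem_preimage, Set.mem_ofPred_eq, LinearIsometryEquiv.coe_toMeasurableEquiv, e, l1Section, hg,
    LinearIsometryEquiv.inner_map_map]

theorem exists_antitone_parallelSection_eq {n : ℕ} (a : EuclideanSpace ℝ (Fin n)) :
    ∃ a' : EuclideanSpace ℝ (Fin n), ∃ σ : Equiv.Perm (Fin n), (∀ i, a' i = |a (σ i)|) ∧
      Antitone a'.ofLp ∧ ‖a'‖ = ‖a‖ ∧ ∀ t, parallelSection a' t = parallelSection a t := by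
  let σ : Equiv.Perm (Fin n) := Tuple.sort (fun i => -|a i|)
  have hσ : Monotone ((fun i => -|a i|) ∘ σ) := Tuple.monotone_sort _
  let g : EuclideanSpace ℝ (Fin n) ≃ₗᵢ[ℝ] EuclideanSpace ℝ (Fin n) :=
    (LinearIsometryEquiv.piLpCongrLeft 2 ℝ ℝ σ.symm).trans
      (LinearIsometryEquiv.piLpCongrRight 2 fun i =>
        if a (σ i) < 0 then LinearIsometryEquiv.neg ℝ else LinearIsometryEquiv.refl ℝ ℝ)
  have hg : ∀ x i, g x i = if a (σ i) < 0 then -x (σ i) else x (σ i) := by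
    intro x i
    by_cases h : a (σ i) < 0 <;> simp [g, h, Equiv.piCongrLeft']
  have hga : ∀ i, g a i = |a (σ i)| := by
    intro i
    rw [hg]
    split_ifs with h
    · rw [abs_of_neg h]
    · rw [abs_of_nonneg (not_lt.1 h)]
  refine ⟨g a, σ, hga, ?_, g.norm_map a, parallelSection_map g ?_ a⟩
  · intro i j hij
    have := hσ hij
    simp only [Function.comp] at this
    rw [hga, hga]
    linarith
  · intro x
    have h1 : ∀ i, |g x i| = |x (σ i)| := by
      intro i
      rw [hg]
      split_ifs <;> simp
    simp only [l1Ball, Set.mem_ofPred_eq, h1]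
    rw [Equiv.sum_comp σ fun i => |x i|]

theorem isCoordinateDirection_iff {n : ℕ} {a : EuclideanSpace ℝ (Fin n)} (ha : ‖a‖ = 1) :
    IsCoordinateDirection a ↔ ∃ j, |a j| = 1 := by
  constructor
  · rintro ⟨j, rfl | rfl⟩ <;> exact ⟨j, by simp⟩
  · rintro ⟨j, hj⟩
    refine ⟨j, ?_⟩
    have h1 : ∑ i, a i ^ 2 = 1 := by
      have := EuclideanSpace.real_norm_sq_eq a
      rw [ha] at this
      linarith
    have h2 : ∀ i, i ≠ j → a i = 0 := by
      intro i hi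
      have h3 : a j ^ 2 + a i ^ 2 ≤ 1 := by
        rw [← h1, ← Finset.sum_pair (f := fun i => a i ^ 2) hi.symm]
        exact Finset.sum_le_sum_of_subset_of_nonneg (Finset.subset_univ _) fun _ _ _ => sq_nonneg _
      have h4 : a j ^ 2 = 1 := by rw [← sq_abs, hj]; norm_num
      have h5 : a i ^ 2 = 0 := le_antisymm (by linarith) (sq_nonneg _)
      exact pow_eq_zero_iff two_ne_zero |>.1 h5
    rcases (abs_eq zero_le_one).1 hj with h | h
    · left
      ext i
      by_cases hi : i = j
      · subst hi; simp [h]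
      · simp [hi, h2 i hi]
    · right
      ext i
      by_cases hi : i = j
      · subst hi; simp [h]
      · simp [hi, h2 i hi]

/-- On the ball `⟨x, a⟩ ≤ t`, and equality forces every coordinate with `|a i| < t` to vanish, so
the projected section lies in a hyperplane. -/
theorem parallelSection_eq_zero {m : ℕ} (a : EuclideanSpace ℝ (Fin (m + 1))) (ha : ‖a‖ = 1)
    (ha0 : 0 < a 0) {t : ℝ} (hat : ∀ i, |a i| ≤ t) {k : Fin m} (hk : |a k.succ| < t) :
    parallelSection a t = 0 := by
  rw [parallelSection_eq_volume_pi a ha ha0]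
  have hsub : {z : Fin m → ℝ | |t - ∑ i, a i.succ * z i| + a 0 * ∑ i, |z i| ≤ a 0} ⊆
      {z | z k = 0} := by
    intro z hz
    simp only [Set.mem_ofPred_eq] at hz ⊢
    by_contra hne
    have hp : 0 < |z k| := abs_pos.2 hne
    have h1 : ∑ i, a i.succ * z i < ∑ i, t * |z i| := by
      refine Finset.sum_lt_sum (fun i _ => ?_) ⟨k, Finset.mem_univ _, ?_⟩
      · refine (le_abs_self _).trans ?_
        rw [abs_mul]
        exact mul_le_mul_of_nonneg_right (hat _) (abs_nonneg _)
      · refine (le_abs_self _).trans_lt ?_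
        rw [abs_mul]
        exact mul_lt_mul_of_pos_right hk hp
    rw [← Finset.mul_sum] at h1
    have h2 := le_abs_self (t - ∑ i, a i.succ * z i)
    have h3 := hat 0
    rw [abs_of_pos ha0] at h3
    have h4 : a 0 * ∑ i, |z i| ≤ a 0 := by linarith [abs_nonneg (t - ∑ i, a i.succ * z i)]
    have h5 : ∑ i, |z i| ≤ 1 := by
      by_contra hc
      nlinarith
    nlinarith
  have : volume {z : Fin m → ℝ | |t - ∑ i, a i.succ * z i| + a 0 * ∑ i, |z i| ≤ a 0} = 0 :=
    measure_mono_null hsub (Measure.pi_hyperplane (fun _ : Fin m => (volume : Measure ℝ)) k 0)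
  rw [this, mul_zero]

/-! ### Profile differences and reduction of the dimension. -/

/-- The one-variable profile `(z - t) ^ (m + 1) / z ^ m`. -/
noncomputable def capProfile (m : ℕ) (t z : ℝ) : ℝ := (z - t) ^ (m + 1) / z ^ m

/-- After clearing denominators the difference factors through `x - y`; with `Y ≤ X` the cofactor is
nonnegative as soon as `Y ≤ 3 t (1 - x)`. -/
theorem div_cube_mul_one_sub_mono {t x y : ℝ} (ht : 0 < t) (ht3 : 1 ≤ 3 * t ^ 2) (hty : t ≤ y) (hyx : y ≤ x)
    (hx : x ^ 2 + t ^ 2 ≤ 1) :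
    ((y - t) / y) ^ 3 * (1 - y) ≤ ((x - t) / x) ^ 3 * (1 - x) := by
  have hy0 : 0 < y := by linarith
  have hx0 : 0 < x := by linarith
  have hx1 : x ≤ 1 := by nlinarith
  have hd : (y - t) * x ≤ 3 * t * (1 - x) := by
    -- Tightest at `t = 1/√3`, `x = √(2/3)`, where `x + t ≈ 1.394`.
    have : (x - t) * x ≤ 3 * t * (1 - x) := by nlinarith [sq_nonneg (x - t), sq_nonneg (x + t - 1.4)]
    nlinarith
  rw [div_pow, div_pow, div_mul_eq_mul_div, div_mul_eq_mul_div, div_le_div_iff₀ (by positivity) (by positivity)]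
  set X := (x - t) * y with hX
  set Y := (y - t) * x with hY
  have hXY : X - Y = t * (x - y) := by rw [hX, hY]; ring
  have hY0 : 0 ≤ Y := mul_nonneg (by linarith) hx0.le
  have hYX : Y ≤ X := by nlinarith
  have e : (x - t) ^ 3 * (1 - x) * y ^ 3 - (y - t) ^ 3 * (1 - y) * x ^ 3 =
      (x - y) * (t * (1 - x) * (X ^ 2 + X * Y + Y ^ 2) - Y ^ 3) := by
    have : (x - t) ^ 3 * (1 - x) * y ^ 3 - (y - t) ^ 3 * (1 - y) * x ^ 3 =
      (X - Y) * (X ^ 2 + X * Y + Y ^ 2) * (1 - x) - Y ^ 3 * (x - y) := by rw [hX, hY]; ring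
    rw [this, hXY]; ring
  have h1 : 3 * Y ^ 2 ≤ X ^ 2 + X * Y + Y ^ 2 := by nlinarith
  have h2 : Y ^ 3 ≤ t * (1 - x) * (X ^ 2 + X * Y + Y ^ 2) := by
    have h3 : t * (1 - x) * (3 * Y ^ 2) ≤ t * (1 - x) * (X ^ 2 + X * Y + Y ^ 2) :=
      mul_le_mul_of_nonneg_left h1 (mul_nonneg ht.le (by linarith))
    have h4 : Y * Y ^ 2 ≤ 3 * t * (1 - x) * Y ^ 2 := mul_le_mul_of_nonneg_right hd (sq_nonneg _)
    nlinarith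
  have := mul_nonneg (sub_nonneg.2 hyx) (sub_nonneg.2 h2)
  linarith

/-- With `u = (z - t)/z`, the quantity `(1 - t) K_k - K_{k+1}` equals `t u^(k+1) (1 - z)`. For `k ≥
2` a factor `u³ (1 - z)` splits off, so it is increasing in `z`. -/
theorem capProfile_sub_succ_le {t x y : ℝ} (ht : 0 < t) (ht3 : 1 ≤ 3 * t ^ 2) (hty : t ≤ y) (hyx : y ≤ x)
    (hx : x ^ 2 + t ^ 2 ≤ 1) {k : ℕ} (hk : 2 ≤ k) :
    capProfile (k + 1) t x - capProfile (k + 1) t y ≤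
      (1 - t) * (capProfile k t x - capProfile k t y) := by
  have hy0 : 0 < y := by linarith
  have hx0 : 0 < x := by linarith
  have hx1 : x ≤ 1 := by nlinarith
  obtain ⟨j, rfl⟩ := Nat.exists_eq_add_of_le' hk
  have e : ∀ z : ℝ, 0 < z → (1 - t) * capProfile (j + 2) t z - capProfile (j + 2 + 1) t z =
      t * (((z - t) / z) ^ j * (((z - t) / z) ^ 3 * (1 - z))) := by
    intro z hz
    unfold capProfile
    rw [div_pow, div_pow]
    field_simp
    ring
  have h1 := e x hx0
  have h2 := e y hy0
  have hle : (y - t) / y ≤ (x - t) / x := by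
    rw [div_le_div_iff₀ hy0 hx0]; nlinarith
  have hn : 0 ≤ (y - t) / y := div_nonneg (by linarith) hy0.le
  have h3 : ((y - t) / y) ^ j * (((y - t) / y) ^ 3 * (1 - y)) ≤ ((x - t) / x) ^ j * (((x - t) / x) ^ 3 * (1 - x)) := by
    refine mul_le_mul (pow_le_pow_left₀ hn hle j) (div_cube_mul_one_sub_mono ht ht3 hty hyx hx)
      (mul_nonneg (pow_nonneg hn _) (by linarith)) (pow_nonneg (hn.trans hle) _)
  nlinarith

theorem capProfile_sub_le_pow_mul {t x y : ℝ} (ht : 0 < t) (ht3 : 1 ≤ 3 * t ^ 2) (hty : t ≤ y) (hyx : y ≤ x)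
    (hx : x ^ 2 + t ^ 2 ≤ 1) (j : ℕ) :
    capProfile (j + 2) t x - capProfile (j + 2) t y ≤
      (1 - t) ^ j * (capProfile 2 t x - capProfile 2 t y) := by
  have ht1 : 0 ≤ 1 - t := by nlinarith
  induction j with
  | zero => simp
  | succ j ih =>
    have := capProfile_sub_succ_le ht ht3 hty hyx hx (k := j + 2) (by omega)
    calc _ ≤ _ := this
      _ ≤ (1 - t) * _ := mul_le_mul_of_nonneg_left ih ht1
      _ = _ := by ring

/-- Extracting `x² - y²` cancels the singular prefactor of the section formula and leaves a quotient
that is continuous at `x = y`. -/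
theorem capProfile_one_sub {t x y : ℝ} (hx : 0 < x) (hy : 0 < y) :
    capProfile 1 t x - capProfile 1 t y = (x ^ 2 - y ^ 2) * ((x * y - t ^ 2) / (x * y * (x + y))) := by
  unfold capProfile
  field_simp
  ring

theorem capProfile_two_sub {t x y : ℝ} (hx : 0 < x) (hy : 0 < y) :
    capProfile 2 t x - capProfile 2 t y = (x ^ 2 - y ^ 2) *
      ((x ^ 2 * y ^ 2 - 3 * t ^ 2 * x * y + t ^ 3 * (x + y)) / (x ^ 2 * y ^ 2 * (x + y))) := by
  unfold capProfile
  field_simp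
  ring

/-! ### Polynomial inequalities in dimensions three and four. -/

theorem four_dim_two_vertex_lt {t x y : ℝ} (ht : 0 < t) (ht3 : 1 ≤ 3 * t ^ 2) (hty : t ≤ y) (hyx : y ≤ x)
    (htx : t < x) (hxy : x ^ 2 + y ^ 2 ≤ 1) :
    x ^ 2 * y ^ 2 - 3 * t ^ 2 * x * y + t ^ 3 * (x + y) <
      (1 - t) ^ 3 * (y ^ 2 * (x + y) * (2 * x ^ 2 + y ^ 2 - 1)) := by
  -- Equality holds at `y = t`. The right side carries the factor `2x² + y² - 3t²`, at most the
  -- target's `2x² + y² - 1`, so only an inequality in `x + y` and `t` is left.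
  have h1 : 2 * (x + y) * (x ^ 2 * y ^ 2 - 3 * t ^ 2 * x * y + t ^ 3 * (x + y)) ≤
      (x + y - 2 * t) * (y ^ 2 * (2 * x ^ 2 + y ^ 2 - 3 * t ^ 2)) := by
    obtain ⟨r, rfl⟩ : ∃ r, y = t + r := ⟨y - t, by ring⟩
    obtain ⟨d, rfl⟩ : ∃ d, x = t + r + d := ⟨x - (t + r), by ring⟩
    have hr : 0 ≤ r := by linarith
    have hd : 0 ≤ d := by linarith
    rw [← sub_nonneg]
    -- From `x² + y² ≤ 1 ≤ 3t²`, dropping the squares of `r` and `r + d`.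
    have hs : 2 * r + d ≤ t / 2 := by
      have : t * (2 * (2 * r + d)) ≤ t * t := by nlinarith [mul_nonneg hr hd]
      linarith [le_of_mul_le_mul_left this ht]
    have h1 : 0 ≤ 2 * t ^ 2 - 2 * t * d - 3 * t * r - 4 * r * d - 4 * r ^ 2 := by
      have h2 := mul_nonneg ht.le (sub_nonneg.2 hs)
      have h3 := mul_nonneg hr (sub_nonneg.2 hs)
      have h4 := mul_nonneg ht.le hr
      have h5 := mul_nonneg ht.le hd
      nlinarith
    have h2 : 0 ≤ r * (d * (t * (2 * t ^ 2 - 2 * t * d - 3 * t * r - 4 * r * d - 4 * r ^ 2)) +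
      (2 * t ^ 2 * r ^ 2 + 4 * t * r ^ 3 + r ^ 3 * d + 2 * r ^ 4)) := by positivity
    linarith
  have h2 : x + y - 2 * t < 2 * (x + y) ^ 2 * (1 - t) ^ 3 := by
    have ht5 : 0.577 ≤ t := by nlinarith
    have ht7 : t ≤ 0.7072 := by nlinarith
    have hw : x + y ≤ 1.4143 := by nlinarith [sq_nonneg (x - y)]
    set q := 1 - t with hq
    have hc : q ^ 3 ≤ 0.08 := by
      have : q ≤ 0.423 := by linarith
      calc q ^ 3 ≤ 0.423 ^ 3 := pow_le_pow_left₀ (by linarith) this 3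
        _ ≤ 0.08 := by norm_num
    -- Replaces `x + y` by its upper bound `1.4143 > √2`; afterwards `h5`, the tangent bound for
    -- `q³` at `0.4`, suffices.
    have h4 : 0 ≤ (1.4143 - (x + y)) * (1 - 2 * q ^ 3 * (1.4143 + (x + y))) := by
      refine mul_nonneg (by linarith) ?_
      have hq0 : 0 ≤ q ^ 3 := pow_nonneg (by linarith) 3
      nlinarith
    have h5 : 0 ≤ (q - 0.4) ^ 2 * (q + 0.8) := mul_nonneg (sq_nonneg _) (by linarith)
    nlinarith
  have hD : 0 < 2 * x ^ 2 + y ^ 2 - 1 := by nlinarith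
  have hD' : 2 * x ^ 2 + y ^ 2 - 3 * t ^ 2 ≤ 2 * x ^ 2 + y ^ 2 - 1 := by linarith
  have hy0 : 0 < y := by linarith
  have hx0 : 0 < x := by linarith
  have h3 : (x + y - 2 * t) * (y ^ 2 * (2 * x ^ 2 + y ^ 2 - 3 * t ^ 2)) ≤
      (x + y - 2 * t) * (y ^ 2 * (2 * x ^ 2 + y ^ 2 - 1)) := by
    refine mul_le_mul_of_nonneg_left (mul_le_mul_of_nonneg_left hD' (sq_nonneg y)) (by linarith)
  have h4 : (x + y - 2 * t) * (y ^ 2 * (2 * x ^ 2 + y ^ 2 - 1)) <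
      2 * (x + y) ^ 2 * (1 - t) ^ 3 * (y ^ 2 * (2 * x ^ 2 + y ^ 2 - 1)) :=
    mul_lt_mul_of_pos_right h2 (by positivity)
  have h5 : 2 * (x + y) * (x ^ 2 * y ^ 2 - 3 * t ^ 2 * x * y + t ^ 3 * (x + y)) <
      2 * (x + y) * ((1 - t) ^ 3 * (y ^ 2 * (x + y) * (2 * x ^ 2 + y ^ 2 - 1))) := by
    nlinarith
  exact lt_of_mul_lt_mul_left h5 (by positivity)

/-- Equality occurs at `x = y = 1/√2`. The defects `e = 1 - x² - y²` and `δ = 1 - 2xy` vanish there,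
and `e ≤ δ` lets `δ` control all losses. -/
theorem three_dim_two_vertex_le {t x y : ℝ} (ht3 : 3 ≤ 8 * t ^ 2) (hy : 0 < y) (hyx : y ≤ x)
    (ht1 : 2 * t ^ 2 ≤ 1)
    (hD : 0 < 2 * x ^ 2 + y ^ 2 - 1) (hxy : x ^ 2 + y ^ 2 ≤ 1) :
    √2 * (x * (x * y - t ^ 2)) ≤ (1 - 2 * t ^ 2) * (y * (x + y) * (2 * x ^ 2 + y ^ 2 - 1)) := by
  have hS : √2 ^ 2 = 2 := Real.sq_sqrt (by norm_num)
  have hS0 : 0 < √2 := by positivity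
  have hx : 0 < x := by linarith
  obtain ⟨e, he⟩ : ∃ e, e = 1 - x ^ 2 - y ^ 2 := ⟨_, rfl⟩
  obtain ⟨δ, hδ⟩ : ∃ δ, δ = 1 - 2 * (x * y) := ⟨_, rfl⟩
  have he0 : 0 ≤ e := by linarith
  have heδ : e ≤ δ := by nlinarith [sq_nonneg (x - y)]
  have hDe : 2 * x ^ 2 + y ^ 2 - 1 = x ^ 2 - e := by rw [he]; ring
  rw [hDe] at hD ⊢
  -- `(x + y)² = 2s` with `s = 1 - (e + δ)/2 ≤ 1`, and `√s ≥ s`.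
  have hw : √2 * (1 - (e + δ) / 2) ≤ x + y := by
    have h1 : (x + y) ^ 2 = 2 * (1 - (e + δ) / 2) := by rw [he, hδ]; ring
    have h2 : x + y ≤ √2 := by
      apply Real.le_sqrt_of_sq_le
      rw [h1]; linarith
    have h3 : √2 * (√2 * (1 - (e + δ) / 2)) ≤ √2 * (x + y) := by
      have : √2 * (√2 * (1 - (e + δ) / 2)) = (x + y) ^ 2 := by rw [h1, ← mul_assoc, ← sq, hS]
      rw [this]
      nlinarith
    exact le_of_mul_le_mul_left h3 hS0
  have hY : (1 - 4 * δ) * (√2 * x) ≤ 2 * (y * (x + y) * (x ^ 2 - e)) := by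
    rcases le_or_gt 0 (1 - δ - 2 * e) with h | h
    · have h1 : x * (1 - δ - 2 * e) ≤ 2 * y * (x ^ 2 - e) := by
        have : x * (1 - δ - 2 * e) = 2 * y * x ^ 2 - 2 * x * e := by rw [hδ]; ring
        rw [this]
        nlinarith
      have h2 : (√2 * (1 - (e + δ) / 2)) * (x * (1 - δ - 2 * e)) ≤ (x + y) * (2 * y * (x ^ 2 - e)) :=
        mul_le_mul hw h1 (by positivity) (by positivity)
      have h3 : 1 - 4 * δ ≤ (1 - (e + δ) / 2) * (1 - δ - 2 * e) := by nlinarith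
      have h4 := mul_le_mul_of_nonneg_right h3 (show 0 ≤ √2 * x by positivity)
      linarith
    · have h1 : 1 - 4 * δ ≤ 0 := by linarith
      have h2 : (1 - 4 * δ) * (√2 * x) ≤ 0 := mul_nonpos_of_nonpos_of_nonneg h1 (by positivity)
      have : 0 ≤ y * (x + y) * (x ^ 2 - e) := by positivity
      linarith
  have h5 := mul_le_mul_of_nonneg_left hY (show 0 ≤ 1 - 2 * t ^ 2 by linarith)
  -- Amounts to `4 (1 - 2t²) ≤ 1` when `δ > 0`, the source of `3 ≤ 8t²`.
  have h6 : 1 - δ - 2 * t ^ 2 ≤ (1 - 2 * t ^ 2) * (1 - 4 * δ) := by nlinarith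
  have h7 := mul_le_mul_of_nonneg_right h6 (show 0 ≤ √2 * x by positivity)
  have h8 : √2 * (x * (x * y - t ^ 2)) = (1 - δ - 2 * t ^ 2) * (√2 * x) / 2 := by rw [hδ]; ring
  rw [h8]
  linarith

theorem three_dim_one_vertex_lt {t x : ℝ} (ht : 0.6383 ≤ t) (htx : t < x) (hx1 : x < 1)
    (hxt : 1 ≤ x ^ 2 + t ^ 2) : (x - t) ^ 2 < (1 - t) ^ 2 * (x * (2 * x ^ 2 - 1)) := by
  obtain ⟨q, rfl⟩ : ∃ q, t = 1 - q := ⟨1 - t, by ring⟩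
  obtain ⟨d, rfl⟩ : ∃ d, x = 1 - d := ⟨1 - x, by ring⟩
  have hd : 0 < d := by linarith
  have hdq : d < q := by linarith
  have hq : q ≤ 0.3617 := by linarith
  -- This is the claimed difference divided by `d`. It is concave in `d`; for `t ≥ 1/√2` its values
  -- at `d = 0` and `d = q` suffice.
  have key : 0 < q * (2 - 5 * q) + d * (6 * q ^ 2 - 1) - 2 * q ^ 2 * d ^ 2 := by
    rcases le_or_gt 1 (2 * (1 - q) ^ 2) with h | h
    · have h1 : 0 < (q - d) * (q * (2 - 5 * q)) := by
        have : 0 < 2 - 5 * q := by linarith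
        have : 0 < q - d := by linarith
        have : 0 < q := by linarith
        positivity
      have h2 : 0 ≤ d * (q * (1 - q) * (2 * (1 - q) ^ 2 - 1)) := by
        have : 0 ≤ 1 - q := by linarith
        have : 0 ≤ q := by linarith
        have : 0 ≤ 2 * (1 - q) ^ 2 - 1 := by linarith
        positivity
      have h3 : 0 ≤ 2 * q ^ 3 * (d * (q - d)) := by
        have : 0 ≤ q - d := by linarith
        have : 0 ≤ q := by linarith
        positivity
      have h4 : 0 < q * (q * (2 - 5 * q) + d * (6 * q ^ 2 - 1) - 2 * q ^ 2 * d ^ 2) := by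
        nlinarith
      exact (pos_iff_pos_of_mul_pos h4).1 (by linarith)
    -- Subtracting `d (x² + t² - 1) ≥ 0` from the goal leaves a function concave in `q`. It is
    -- positive at the ends `q = r`, that is `t = 1/√2` (`hA`), and `q = 0.3617` (`hB`); `hC` is the
    -- concavity term.
    · obtain ⟨r, hr⟩ : ∃ r, r = 1 - √2 / 2 := ⟨_, rfl⟩
      have hS : √2 ^ 2 = 2 := Real.sq_sqrt (by norm_num)
      have hr2 : r ^ 2 = 2 * r - 1 / 2 := by rw [hr]; nlinarith
      have hr3 : r < 0.293 := by rw [hr]; nlinarith [Real.sqrt_nonneg 2]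
      have hr3' : 0.2928 < r := by rw [hr]; nlinarith [Real.sqrt_nonneg 2]
      have hqr : r < q := by nlinarith
      have hdr : d < r := by nlinarith
      have hA : 0 < (r - d) * (d ^ 2 + (5 * r - 3) * d + 2 - 5 * r) := by
        refine mul_pos (by linarith) ?_
        nlinarith [sq_nonneg (d - r)]
      have hB : 0 < 0.3617 * (2 - 5 * 0.3617) - d * (2 - 2 * 0.3617 - 5 * 0.3617 ^ 2) +
          d ^ 2 * (2 - 2 * 0.3617 ^ 2) - d ^ 3 := by
        nlinarith [sq_nonneg (d - 0.22), mul_nonneg (sub_nonneg.2 hdr.le) (sq_nonneg (d - 0.22))]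
      have hC : 0 ≤ (0.3617 - r) * ((0.3617 - q) * (q - r) * (5 - 5 * d + 2 * d ^ 2)) := by
        have h5 : 0 ≤ 5 - 5 * d + 2 * d ^ 2 := by
          have := sq_nonneg d
          linarith
        exact mul_nonneg (by linarith) (mul_nonneg (mul_nonneg (by linarith) (by linarith)) h5)
      have hA' : (r - d) * (d ^ 2 + (5 * r - 3) * d + 2 - 5 * r) =
          r * (2 - 5 * r) - d * (2 - 2 * r - 5 * r ^ 2) + d ^ 2 * (2 - 2 * r ^ 2) - d ^ 3 := by
        linear_combination 2 * d ^ 2 * hr2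
      rw [hA'] at hA
      have hR : 0 < (0.3617 - r) * (q * (2 - 5 * q) - d * (2 - 2 * q - 5 * q ^ 2) +
          d ^ 2 * (2 - 2 * q ^ 2) - d ^ 3) := by
        have h1 := mul_nonneg (sub_nonneg.2 hq) hA.le
        have h2 := mul_pos (sub_pos.2 hqr) hB
        linarith
      have hR' := (pos_iff_pos_of_mul_pos hR).1 (by linarith)
      have := mul_nonneg hd.le (sub_nonneg.2 hxt)
      linarith
  have := mul_pos hd key
  nlinarith

theorem four_dim_one_vertex_lt {t x : ℝ} (ht : 0 < t) (ht3 : 1 ≤ 3 * t ^ 2) (htx : t < x) (hx1 : x < 1)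
    (hxt : 1 ≤ x ^ 2 + t ^ 2) : (x - t) ^ 3 < (1 - t) ^ 3 * (x ^ 2 * (2 * x ^ 2 - 1)) := by
  rcases le_or_gt 0.6383 t with h | h
  · have h1 := three_dim_one_vertex_lt h htx hx1 hxt
    have h2 : x - t ≤ (1 - t) * x := by nlinarith
    calc (x - t) ^ 3 = (x - t) * (x - t) ^ 2 := by ring
      _ < (x - t) * ((1 - t) ^ 2 * (x * (2 * x ^ 2 - 1))) := mul_lt_mul_of_pos_left h1 (by linarith)
      _ ≤ ((1 - t) * x) * ((1 - t) ^ 2 * (x * (2 * x ^ 2 - 1))) := by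
        refine mul_le_mul_of_nonneg_right h2 ?_
        exact (sq_nonneg _).trans h1.le
      _ = _ := by ring
  · have ht5 : 0.57735 ≤ t := by nlinarith
    obtain ⟨q, rfl⟩ : ∃ q, t = 1 - q := ⟨1 - t, by ring⟩
    obtain ⟨d, rfl⟩ : ∃ d, x = 1 - d := ⟨1 - x, by ring⟩
    have hd : 0 < d := by linarith
    have hq : q ≤ 0.42265 := by linarith
    have hq' : 0.3617 ≤ q := by linarith
    have hd' : d ≤ 0.2303 := by nlinarith
    -- The difference divided by `d`, without the nonnegative term `2 q³ d³`. It is expanded around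
    -- the largest admissible `d`; all three coefficients in `v` are nonnegative.
    have key : 0 < q ^ 3 * (-6 + 11 * d - 8 * d ^ 2) + 3 * q ^ 2 - 3 * q * d + d ^ 2 := by
      obtain ⟨v, rfl⟩ : ∃ v, d = 0.2303 - v := ⟨0.2303 - d, by ring⟩
      have hv : 0 ≤ v := by linarith
      have hq3 : q ^ 3 ≤ 0.0756 := by
        calc q ^ 3 ≤ 0.42265 ^ 3 := pow_le_pow_left₀ (by linarith) hq 3
          _ ≤ 0.0756 := by norm_num
      have h1 : 0 < q ^ 3 * (-6 + 11 * 0.2303 - 8 * 0.2303 ^ 2) + 3 * q ^ 2 - 3 * q * 0.2303 + 0.2303 ^ 2 := by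
        nlinarith [mul_nonneg (sub_nonneg.2 hq) (sub_nonneg.2 hq'),
          mul_nonneg (mul_nonneg (sub_nonneg.2 hq) (sub_nonneg.2 hq')) (show 0 ≤ q by linarith)]
      have h2 : 0 ≤ v * (3 * q - 0.4606 - q ^ 3 * (11 - 3.6848)) := mul_nonneg hv (by nlinarith)
      have h3 : 0 ≤ v ^ 2 * (1 - 8 * q ^ 3) := mul_nonneg (sq_nonneg v) (by nlinarith)
      nlinarith
    have := mul_pos hd key
    have : 0 ≤ q ^ 3 * d ^ 4 := by positivity
    nlinarith

/-! ### Weierstrass product inequalities and the vertex factor. -/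

theorem one_sub_sum_le_prod {ι : Type*} (s : Finset ι) {p : ι → ℝ} (h0 : ∀ i ∈ s, 0 ≤ p i)
    (h1 : ∀ i ∈ s, p i ≤ 1) : 1 - ∑ i ∈ s, p i ≤ ∏ i ∈ s, (1 - p i) := by
  classical
  induction s using Finset.induction_on with
  | empty => simp
  | insert a s ha ih =>
    rw [Finset.sum_insert ha, Finset.prod_insert ha]
    have ih' := ih (fun i hi => h0 i (Finset.mem_insert_of_mem hi)) fun i hi => h1 i (Finset.mem_insert_of_mem hi)
    have ha0 := h0 a (Finset.mem_insert_self _ _)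
    have ha1 := h1 a (Finset.mem_insert_self _ _)
    have hs : 0 ≤ ∑ i ∈ s, p i := Finset.sum_nonneg fun i hi => h0 i (Finset.mem_insert_of_mem hi)
    have := mul_le_mul_of_nonneg_left ih' (sub_nonneg.2 ha1)
    nlinarith

/-- With every `p i` capped by `T`, the comparison configuration has one entry `T` and puts the
remaining mass in a single other entry. -/
theorem one_sub_mul_one_sub_sum_le_prod {ι : Type*} (s : Finset ι) {p : ι → ℝ} {T : ℝ} (hT : T ≤ 1)
    (h0 : ∀ i ∈ s, 0 ≤ p i) (h1 : ∀ i ∈ s, p i ≤ T) (hs : T ≤ ∑ i ∈ s, p i) (hT0 : 0 ≤ T) :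
    (1 - T) * (1 - ∑ i ∈ s, p i + T) ≤ ∏ i ∈ s, (1 - p i) := by
  classical
  induction s using Finset.induction_on with
  | empty =>
    simp at hs ⊢
    nlinarith
  | insert a s ha ih =>
    rw [Finset.sum_insert ha] at hs ⊢
    rw [Finset.prod_insert ha]
    have h0' : ∀ i ∈ s, 0 ≤ p i := fun i hi => h0 i (Finset.mem_insert_of_mem hi)
    have h1' : ∀ i ∈ s, p i ≤ T := fun i hi => h1 i (Finset.mem_insert_of_mem hi)
    have ha0 := h0 a (Finset.mem_insert_self _ _)
    have ha1 := h1 a (Finset.mem_insert_self _ _)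
    rcases le_total T (∑ i ∈ s, p i) with h | h
    · have := mul_le_mul_of_nonneg_left (ih h0' h1' h) (show 0 ≤ 1 - p a by linarith)
      refine le_trans ?_ this
      have h2 : 0 ≤ p a * (∑ i ∈ s, p i - T) * (1 - T) :=
        mul_nonneg (mul_nonneg ha0 (by linarith)) (by linarith)
      have h3 : 0 ≤ p a * (1 - T) := mul_nonneg ha0 (by linarith)
      nlinarith
    · have h2 := one_sub_sum_le_prod s h0' fun i hi => (h1' i hi).trans hT
      have := mul_le_mul_of_nonneg_left h2 (show 0 ≤ 1 - p a by linarith)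
      refine le_trans ?_ this
      have h3 : 0 ≤ (T - p a) * (T - ∑ i ∈ s, p i) := mul_nonneg (by linarith) (by linarith)
      nlinarith

/-- The product `∏ z² / (z² - bᵢ²)`. -/
noncomputable def vertexFactor {m : ℕ} (b : Fin m → ℝ) (z : ℝ) : ℝ := ∏ i, (z ^ 2 / (z ^ 2 - b i ^ 2))

section
variable {m : ℕ} {b : Fin m → ℝ} {t x y z : ℝ}

theorem slabMass_eq (htz : t ≤ z) (hz : 0 < z) : slabMass b t z =
    2 ^ m / (m + 1).factorial * (capProfile m t z * vertexFactor b z) := by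
  have h : ∀ i, 2 * z / (z ^ 2 - b i ^ 2) = (2 / z) * (z ^ 2 / (z ^ 2 - b i ^ 2)) := by
    intro i
    field_simp
  unfold slabMass vertexFactor capProfile
  simp only [h]
  rw [Finset.prod_mul_distrib, Finset.prod_const, max_eq_left (sub_nonneg.2 htz)]
  simp only [Finset.card_univ, Fintype.card_fin, div_pow]
  field_simp

theorem sq_sub_sq_pos_of_lt (hb : ∀ i, 0 ≤ b i) (hbz : ∀ i, b i < z) (i : Fin m) : 0 < z ^ 2 - b i ^ 2 := by
  nlinarith [hb i, hbz i]

theorem vertexFactor_nonneg (hb : ∀ i, 0 ≤ b i) (hbz : ∀ i, b i < z) : 0 ≤ vertexFactor b z :=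
  Finset.prod_nonneg fun i _ => div_nonneg (sq_nonneg z) (sq_sub_sq_pos_of_lt hb hbz i).le

theorem vertexFactor_anti (hb : ∀ i, 0 ≤ b i) (hby : ∀ i, b i < y) (hy : 0 < y) (hyx : y ≤ x) :
    vertexFactor b x ≤ vertexFactor b y := by
  have hbx : ∀ i, b i < x := fun i => (hby i).trans_le hyx
  refine Finset.prod_le_prod (fun i _ => div_nonneg (sq_nonneg x) (sq_sub_sq_pos_of_lt hb hbx i).le) fun i _ => ?_
  rw [div_le_div_iff₀ (sq_sub_sq_pos_of_lt hb hbx i) (sq_sub_sq_pos_of_lt hb hby i)]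
  have : y ^ 2 ≤ x ^ 2 := pow_le_pow_left₀ hy.le hyx 2
  nlinarith [mul_nonneg (sub_nonneg.2 this) (sq_nonneg (b i))]

theorem vertexFactor_eq (hz : 0 < z) (hb : ∀ i, 0 ≤ b i) (hbz : ∀ i, b i < z) :
    vertexFactor b z = (∏ i, (1 - b i ^ 2 / z ^ 2))⁻¹ := by
  unfold vertexFactor
  rw [← Finset.prod_inv_distrib]
  refine Finset.prod_congr rfl fun i _ => ?_
  have := (sq_sub_sq_pos_of_lt hb hbz i).ne'
  have h2 : 1 - b i ^ 2 / z ^ 2 = (z ^ 2 - b i ^ 2) / z ^ 2 := by field_simp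
  rw [h2, inv_div]

theorem vertexFactor_le (hz : 0 < z) (hb : ∀ i, 0 ≤ b i) (hbz : ∀ i, b i < z)
    (hs : ∑ i, b i ^ 2 < z ^ 2) : vertexFactor b z ≤ z ^ 2 / (z ^ 2 - ∑ i, b i ^ 2) := by
  rw [vertexFactor_eq hz hb hbz]
  have h1 := one_sub_sum_le_prod Finset.univ (p := fun i => b i ^ 2 / z ^ 2) (fun i _ => by positivity)
    (fun i _ => by
      have := sq_sub_sq_pos_of_lt hb hbz i
      rw [div_le_one (by positivity)]; linarith)
  rw [← Finset.sum_div] at h1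
  have h2 : 1 - (∑ i, b i ^ 2) / z ^ 2 = (z ^ 2 - ∑ i, b i ^ 2) / z ^ 2 := by field_simp
  rw [h2] at h1
  have h3 : 0 < (z ^ 2 - ∑ i, b i ^ 2) / z ^ 2 := div_pos (by linarith) (by positivity)
  calc _ ≤ ((z ^ 2 - ∑ i, b i ^ 2) / z ^ 2)⁻¹ := inv_anti₀ h3 h1
    _ = _ := inv_div _ _

theorem vertexFactor_le_two (hz : 0 < z) (ht : 0 ≤ t) (hb : ∀ i, 0 ≤ b i) (htz : t < z) (hbt : ∀ i, b i ≤ t)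
    (hs : t ^ 2 ≤ ∑ i, b i ^ 2) (hs2 : ∑ i, b i ^ 2 < z ^ 2 + t ^ 2) :
    vertexFactor b z ≤ z ^ 4 / ((z ^ 2 - t ^ 2) * (z ^ 2 - ∑ i, b i ^ 2 + t ^ 2)) := by
  rw [vertexFactor_eq hz hb fun i => (hbt i).trans_lt htz]
  have htz2 : t ^ 2 < z ^ 2 := pow_lt_pow_left₀ htz ht two_ne_zero
  have h1 := one_sub_mul_one_sub_sum_le_prod Finset.univ (p := fun i => b i ^ 2 / z ^ 2)
    (T := t ^ 2 / z ^ 2) (by rw [div_le_one (by positivity)]; exact htz2.le)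
    (fun i _ => by positivity)
    (fun i _ => by
      have := pow_le_pow_left₀ (hb i) (hbt i) 2
      gcongr)
    (by rw [← Finset.sum_div]; gcongr) (by positivity)
  rw [← Finset.sum_div] at h1
  have h2 : (1 - t ^ 2 / z ^ 2) * (1 - (∑ i, b i ^ 2) / z ^ 2 + t ^ 2 / z ^ 2) =
    ((z ^ 2 - t ^ 2) * (z ^ 2 - ∑ i, b i ^ 2 + t ^ 2)) / z ^ 4 := by field_simp
  rw [h2] at h1
  have h3 : 0 < ((z ^ 2 - t ^ 2) * (z ^ 2 - ∑ i, b i ^ 2 + t ^ 2)) / z ^ 4 :=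
    div_pos (mul_pos (by linarith) (by linarith)) (by positivity)
  calc _ ≤ (((z ^ 2 - t ^ 2) * (z ^ 2 - ∑ i, b i ^ 2 + t ^ 2)) / z ^ 4)⁻¹ := inv_anti₀ h3 h1
    _ = _ := inv_div _ _

theorem capProfile_nonneg (htz : t ≤ z) (hz : 0 < z) : 0 ≤ capProfile m t z :=
  div_nonneg (pow_nonneg (sub_nonneg.2 htz) _) (pow_nonneg hz.le _)

/-- The vertex factor at `y` is at least that at `x`, so it may be replaced by the latter in the
subtracted term. -/
theorem slabMass_sub_le {Q : ℝ} (ht : 0 < t) (hb : ∀ i, 0 ≤ b i) (hbt : ∀ i, b i ≤ t) (hty : t < y) (hyx : y < x)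
    (hs : ∑ i, b i ^ 2 < x ^ 2) (hQ : capProfile m t x - capProfile m t y ≤ (x ^ 2 - y ^ 2) * Q)
    (hQ0 : 0 ≤ Q) :
    slabMass b t x - slabMass b t y ≤ 2 ^ m / (m + 1).factorial *
      (x ^ 2 / (x ^ 2 - ∑ i, b i ^ 2) * ((x ^ 2 - y ^ 2) * Q)) := by
  have hy : 0 < y := by linarith
  have hx : 0 < x := by linarith
  have hby : ∀ i, b i < y := fun i => (hbt i).trans_lt hty
  have hbx : ∀ i, b i < x := fun i => (hby i).trans hyx
  rw [slabMass_eq hty.le hy, slabMass_eq (hty.trans hyx).le hx, ← mul_sub]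
  refine mul_le_mul_of_nonneg_left ?_ (by positivity)
  have h1 := mul_le_mul_of_nonneg_left (vertexFactor_anti hb hby hy hyx.le) (capProfile_nonneg (m := m) hty.le hy)
  calc _ ≤ vertexFactor b x * (capProfile m t x - capProfile m t y) := by linarith
    _ ≤ vertexFactor b x * ((x ^ 2 - y ^ 2) * Q) := mul_le_mul_of_nonneg_left hQ (vertexFactor_nonneg hb hbx)
    _ ≤ _ := mul_le_mul_of_nonneg_right (vertexFactor_le hx hb hbx hs) (mul_nonneg (by nlinarith) hQ0)

end

/-! ### Case analysis on the coordinates exceeding `t`. -/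

theorem norm_sq_eq_add_sum {m : ℕ} {a : EuclideanSpace ℝ (Fin (m + 2))} (ha : ‖a‖ = 1) :
    a 0 ^ 2 + a 1 ^ 2 + ∑ i : Fin m, a i.succ.succ ^ 2 = 1 := by
  have h := EuclideanSpace.real_norm_sq_eq a
  rw [ha, Fin.sum_univ_succ, Fin.sum_univ_succ] at h
  have e : (Fin.succ 0 : Fin (m + 2)) = 1 := rfl
  rw [e] at h
  linarith

/-- `Q` majorizes the divided difference of the profile. Keeping `P` abstract serves strict and weak
bounds alike, in all dimensions. -/
theorem exists_bound_of_antitone {m : ℕ} {a : EuclideanSpace ℝ (Fin (m + 2))} (ha : ‖a‖ = 1)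
    (hn : ∀ i, 0 ≤ a i) (hanti : Antitone a.ofLp) (ha1 : a 0 < 1) {t : ℝ} (ht : 0 < t)
    (ht3 : 1 ≤ 3 * t ^ 2) (htm : 1 < (m + 2) * t ^ 2) {Q : ℝ → ℝ → ℝ}
    (hQc : ∀ z, 0 < z → ContinuousAt (fun x => Q x z) z)
    (hQ0 : ∀ x y, t ≤ y → y ≤ x → 0 ≤ Q x y)
    (hQ : ∀ x y, t ≤ y → y < x → x ^ 2 + t ^ 2 ≤ 1 →
      capProfile m t x - capProfile m t y ≤ (x ^ 2 - y ^ 2) * Q x y)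
    {P : ℝ → Prop} (hP0 : P 0)
    (hP1 : ∀ x, t < x → x < 1 → 1 ≤ x ^ 2 + t ^ 2 → P (capProfile m t x / (2 * x ^ 2 - 1)))
    (hP2 : ∀ x y, t ≤ y → y ≤ x → t < x → x ^ 2 + y ^ 2 ≤ 1 →
      P (x ^ 2 * Q x y / (2 * x ^ 2 + y ^ 2 - 1))) :
    ∃ v, P v ∧ parallelSection a t ≤ ENNReal.ofReal (2 ^ (m + 1) / (m + 1).factorial * v) := by
  have hsum := norm_sq_eq_add_sum ha
  have h10 : a 1 ≤ a 0 := hanti (Fin.zero_le _)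
  have hb1 : ∀ i : Fin m, a i.succ.succ ≤ a 1 := fun i =>
    hanti (show (Fin.succ 0 : Fin (m + 2)) ≤ i.succ.succ from Fin.succ_le_succ_iff.2 (Fin.zero_le _))
  have hbn : ∀ i : Fin m, 0 ≤ a i.succ.succ := fun i => hn _
  rcases le_or_gt (a 0) t with h0 | h0
  · refine ⟨0, hP0, ?_⟩
    have hex : ∃ k : Fin (m + 1), a k.succ < t := by
      by_contra! hc
      have h1 : t ≤ a 1 := hc 0
      have h2 : ∑ i : Fin m, t ^ 2 ≤ ∑ i : Fin m, a i.succ.succ ^ 2 :=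
        Finset.sum_le_sum fun i _ => pow_le_pow_left₀ ht.le (hc i.succ) 2
      simp at h2
      nlinarith
    obtain ⟨k, hk⟩ := hex
    have h00 : 0 < a 0 := by
      by_contra hc
      have hz : ∀ i, a i = 0 := fun i =>
        le_antisymm ((hanti (Fin.zero_le i)).trans (not_lt.1 hc)) (hn i)
      simp [hz] at hsum
    have hat : ∀ i, |a i| ≤ t := fun i => by
      rw [abs_of_nonneg (hn i)]
      exact (hanti (Fin.zero_le i)).trans h0
    rw [parallelSection_eq_zero a ha h00 hat (k := k) (by rwa [abs_of_nonneg (hn _)])]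
    exact zero_le
  have hx0 : 0 < a 0 := by linarith
  have hbt : ∀ i : Fin m, a i.succ.succ ≤ t := by
    intro i
    by_contra hc
    have h1 : a i.succ.succ ^ 2 ≤ ∑ i : Fin m, a i.succ.succ ^ 2 :=
      Finset.single_le_sum (f := fun i : Fin m => a i.succ.succ ^ 2) (fun j _ => sq_nonneg _) (Finset.mem_univ i)
    have h2 := hb1 i
    nlinarith
  have habs : ∀ i : Fin m, |a i.succ.succ| = a i.succ.succ := fun i => abs_of_nonneg (hbn i)
  have hS0 : 0 ≤ ∑ i : Fin m, a i.succ.succ ^ 2 := Finset.sum_nonneg fun i _ => sq_nonneg _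
  rcases le_or_gt (a 1) t with h1 | h1
  · -- only the first coordinate exceeds `t`
    have h01 : a 1 < a 0 := by linarith
    have hsq : 0 < a 0 ^ 2 - a 1 ^ 2 := by nlinarith [hn 1]
    -- Since `a 1 ≤ t`, its vertex term is dropped, and `1 / (a 0 ^ 2 - a 1 ^ 2)` becomes one more
    -- factor of the product.
    let w : Fin (m + 1) → ℝ := fun i => a i.succ
    have hw0 : ∀ i, 0 ≤ w i := fun i => hn _
    have hwt : ∀ i, w i ≤ t := by
      intro i
      refine Fin.cases h1 (fun j => hbt j) i
    have hws : ∑ i, w i ^ 2 = 1 - a 0 ^ 2 := by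
      rw [Fin.sum_univ_succ]
      have : w 0 = a 1 := rfl
      rw [this]
      simp only [w]
      linarith
    have hA : parallelSection a t ≤ ENNReal.ofReal (2 ^ (m + 1) / (m + 1).factorial *
        (capProfile m t (a 0) / a 0 ^ 2 * vertexFactor w (a 0))) := by
      rw [parallelSection_eq_slabMass a ha (hn 1) h01 ht.le (fun i => by rw [habs]; exact hb1 i)
        (fun i => by rw [habs]; exact hbt i)]
      refine ENNReal.ofReal_le_ofReal ?_
      have hJ := slabMass_nonneg (b := fun i : Fin m => a i.succ.succ) (t := t) (z := a 1)
        (fun i => by rw [habs]; exact hb1 i) (hn 1)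
      have hv : vertexFactor w (a 0) = a 0 ^ 2 / (a 0 ^ 2 - a 1 ^ 2) *
          vertexFactor (fun i : Fin m => a i.succ.succ) (a 0) := by
        unfold vertexFactor
        rw [Fin.prod_univ_succ]
        rfl
      rw [hv]
      calc _ ≤ 2 / (a 0 ^ 2 - a 1 ^ 2) * slabMass (fun i : Fin m => a i.succ.succ) t (a 0) :=
            mul_le_mul_of_nonneg_left (by linarith) (by positivity)
        _ = _ := by
          rw [slabMass_eq h0.le hx0]
          field_simp
          ring
    have hK := capProfile_nonneg (m := m) h0.le hx0
    -- The squares of the remaining coordinates sum to `1 - a 0 ^ 2`. If this exceeds `t²`, the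
    -- capped product bound reproduces the two-vertex expression at `y = t`.
    rcases le_or_gt 1 (a 0 ^ 2 + t ^ 2) with h2 | h2
    · refine ⟨_, hP1 (a 0) h0 ha1 h2, hA.trans (ENNReal.ofReal_le_ofReal ?_)⟩
      refine mul_le_mul_of_nonneg_left ?_ (by positivity)
      have h3 := vertexFactor_le hx0 hw0 (fun i => (hwt i).trans_lt h0) (by rw [hws]; nlinarith)
      rw [hws] at h3
      calc _ ≤ capProfile m t (a 0) / a 0 ^ 2 * (a 0 ^ 2 / (a 0 ^ 2 - (1 - a 0 ^ 2))) :=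
            mul_le_mul_of_nonneg_left h3 (by positivity)
        _ = _ := by
          rw [show a 0 ^ 2 - (1 - a 0 ^ 2) = 2 * a 0 ^ 2 - 1 by ring]
          field_simp
    · refine ⟨_, hP2 (a 0) t le_rfl h0.le h0 h2.le, hA.trans (ENNReal.ofReal_le_ofReal ?_)⟩
      refine mul_le_mul_of_nonneg_left ?_ (by positivity)
      have h3 := vertexFactor_le_two hx0 ht.le hw0 h0 hwt (by rw [hws]; linarith) (by rw [hws]; nlinarith)
      rw [hws] at h3
      have h4 := hQ (a 0) t le_rfl h0 h2.le
      have h5 : capProfile m t t = 0 := by simp [capProfile]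
      rw [h5, sub_zero] at h4
      have h6 : 0 < a 0 ^ 2 - t ^ 2 := by nlinarith
      have h7 : 0 < 2 * a 0 ^ 2 + t ^ 2 - 1 := by nlinarith
      rw [show a 0 ^ 2 - (1 - a 0 ^ 2) + t ^ 2 = 2 * a 0 ^ 2 + t ^ 2 - 1 by ring] at h3
      calc _ ≤ capProfile m t (a 0) / a 0 ^ 2 * (a 0 ^ 4 / ((a 0 ^ 2 - t ^ 2) * (2 * a 0 ^ 2 + t ^ 2 - 1))) :=
            mul_le_mul_of_nonneg_left h3 (by positivity)
        _ ≤ ((a 0 ^ 2 - t ^ 2) * Q (a 0) t) / a 0 ^ 2 *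
            (a 0 ^ 4 / ((a 0 ^ 2 - t ^ 2) * (2 * a 0 ^ 2 + t ^ 2 - 1))) := by gcongr
        _ = _ := by field_simp
  · have hS : ∑ i : Fin m, a i.succ.succ ^ 2 < a 0 ^ 2 := by nlinarith
    have hD : a 0 ^ 2 - ∑ i : Fin m, a i.succ.succ ^ 2 = 2 * a 0 ^ 2 + a 1 ^ 2 - 1 := by linarith
    refine ⟨_, hP2 (a 0) (a 1) h1.le h10 h0 (by linarith), ?_⟩
    rcases h10.lt_or_eq with h01 | h01
    · have hsq : 0 < a 0 ^ 2 - a 1 ^ 2 := by nlinarith [hn 1]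
      rw [parallelSection_eq_slabMass a ha (hn 1) h01 ht.le (fun i => by rw [habs]; exact hb1 i)
        (fun i => by rw [habs]; exact hbt i)]
      refine ENNReal.ofReal_le_ofReal ?_
      have h3 := slabMass_sub_le ht hbn hbt h1 h01 hS (hQ _ _ h1.le h01 (by nlinarith)) (hQ0 _ _ h1.le h01.le)
      rw [hD] at h3
      have hD' : 0 < 2 * a 0 ^ 2 + a 1 ^ 2 - 1 := by linarith
      calc _ ≤ 2 / (a 0 ^ 2 - a 1 ^ 2) * _ := mul_le_mul_of_nonneg_left h3 (by positivity)
        _ = _ := by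
          field_simp
          ring
    · -- the two largest coordinates coincide
      set x := a 0 with hx
      set S := ∑ i : Fin m, a i.succ.succ ^ 2 with hSdef
      have hD' : 2 * x ^ 2 + a 1 ^ 2 - 1 = x ^ 2 - S := hD.symm
      rw [hD', h01]
      -- The factor `(x' + x) / (2x)`, tending to `1`, is the ratio of the tied prefactor `1 / (x
      -- (x' - x))` to `2 / (x'² - x²)`.
      have hlim : Filter.Tendsto (fun x' : ℝ => ENNReal.ofReal (2 ^ (m + 1) / (m + 1).factorial *
          ((x' + x) / (2 * x) * (x' ^ 2 * Q x' x / (x' ^ 2 - S))))) (nhdsWithin x (Set.Ioi x))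
          (nhds (ENNReal.ofReal (2 ^ (m + 1) / (m + 1).factorial * (x ^ 2 * Q x x / (x ^ 2 - S))))) := by
        have hc : ContinuousAt (fun x' : ℝ => 2 ^ (m + 1) / ((m + 1).factorial : ℝ) *
          ((x' + x) / (2 * x) * (x' ^ 2 * Q x' x / (x' ^ 2 - S)))) x := by
          have := hQc x hx0
          have hne : x ^ 2 - S ≠ 0 := by linarith
          fun_prop (disch := assumption)
        have h2 := (ENNReal.tendsto_ofReal hc.tendsto).mono_left (nhdsWithin_le_nhds (s := Set.Ioi x))
        have e : (x + x) / (2 * x) = 1 := by field_simp; ring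
        simpa only [e, one_mul] using h2
      refine ge_of_tendsto hlim ?_
      have hev : ∀ᶠ x' in nhdsWithin x (Set.Ioi x), x' ^ 2 + t ^ 2 < 1 := by
        refine nhdsWithin_le_nhds ?_
        have hc : Continuous fun x' : ℝ => x' ^ 2 + t ^ 2 := by fun_prop
        refine hc.continuousAt.eventually_lt continuousAt_const ?_
        nlinarith
      filter_upwards [hev, self_mem_nhdsWithin] with x' hx' hxx
      have hxx' : x < x' := hxx
      refine (parallelSection_le_slabMass a ha hx0 h01 ht.le (fun i => by rw [habs]; exact (hb1 i).trans h01.le)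
        (fun i => by rw [habs]; exact hbt i) hxx').trans (ENNReal.ofReal_le_ofReal ?_)
      have hS' : S < x' ^ 2 := by nlinarith
      have h3 := slabMass_sub_le ht hbn hbt h0 hxx' hS' (hQ _ _ h0.le hxx' hx'.le) (hQ0 _ _ h0.le hxx'.le)
      rw [← hSdef] at h3
      have hp : 0 < x' - x := by linarith
      have hp2 : 0 < x' ^ 2 - S := by linarith
      calc _ ≤ 1 / (x * (x' - x)) * _ := mul_le_mul_of_nonneg_left h3 (by positivity)
        _ = _ := by
          field_simp
          ring

theorem parallelSection_single_zero (m : ℕ) {t : ℝ} (ht : 0 ≤ t) (ht1 : t ≤ 1) :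
    parallelSection (EuclideanSpace.single (0 : Fin (m + 2)) (1 : ℝ)) t =
      ENNReal.ofReal (2 ^ (m + 1) / (m + 1).factorial * (1 - t) ^ (m + 1)) := by
  have h2 : ∀ i : Fin m, EuclideanSpace.single (0 : Fin (m + 2)) (1 : ℝ) i.succ.succ = 0 := by
    intro i
    simp
  rw [parallelSection_eq_slabMass _ (by simp) (by simp) (by simp) ht (fun i => by simp)
    (fun i => by simpa using ht)]
  congr 1
  simp [slabMass, max_eq_left (sub_nonneg.2 ht1), max_eq_right (neg_nonpos.2 ht), pow_succ]
  field_simp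

theorem eq_single_of_antitone {m : ℕ} {a : EuclideanSpace ℝ (Fin (m + 2))} (ha : ‖a‖ = 1)
    (h0 : a 0 = 1) : a = EuclideanSpace.single (0 : Fin (m + 2)) (1 : ℝ) := by
  have h := EuclideanSpace.real_norm_sq_eq a
  rw [ha, Fin.sum_univ_succ, h0] at h
  have h1 : ∑ i : Fin (m + 1), a i.succ ^ 2 = 0 := by linarith
  rw [Finset.sum_eq_zero_iff_of_nonneg fun i _ => sq_nonneg _] at h1
  ext i
  refine Fin.cases ?_ (fun j => ?_) i
  · simp [h0]
  · have := h1 j (Finset.mem_univ j)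
    simpa using this

theorem abs_le_one_of_norm_eq_one {n : ℕ} {a : EuclideanSpace ℝ (Fin n)} (ha : ‖a‖ = 1) (i : Fin n) :
    |a i| ≤ 1 := by
  have h := EuclideanSpace.real_norm_sq_eq a
  have h2 : a i ^ 2 ≤ ∑ i, a i ^ 2 :=
    Finset.single_le_sum (f := fun i => a i ^ 2) (fun j _ => sq_nonneg _) (Finset.mem_univ i)
  rw [← h, ha, one_pow] at h2
  exact (sq_le_one_iff_abs_le_one _).1 h2

theorem parallelSection_of_isCoordinateDirection {m : ℕ} {a : EuclideanSpace ℝ (Fin (m + 2))}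
    (ha : ‖a‖ = 1) (h : IsCoordinateDirection a) (t : ℝ) :
    parallelSection a t = parallelSection (EuclideanSpace.single (0 : Fin (m + 2)) (1 : ℝ)) t := by
  obtain ⟨a', σ, h1, h2, h3, h4⟩ := exists_antitone_parallelSection_eq a
  obtain ⟨j, hj⟩ := (isCoordinateDirection_iff ha).1 h
  have h5 : a' (σ.symm j) = 1 := by rw [h1, Equiv.apply_symm_apply, hj]
  have h6 : a' 0 = 1 := by
    refine le_antisymm ?_ ?_
    · rw [h1]; exact abs_le_one_of_norm_eq_one ha _
    · rw [← h5]; exact h2 (Fin.zero_le _)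
  rw [← h4, eq_single_of_antitone (h3.trans ha) h6]

theorem exists_bound_of_not_isCoordinateDirection {m : ℕ} {a : EuclideanSpace ℝ (Fin (m + 2))}
    (ha : ‖a‖ = 1) (hnc : ¬ IsCoordinateDirection a) {t : ℝ} (ht : 0 < t)
    (ht3 : 1 ≤ 3 * t ^ 2) (htm : 1 < (m + 2) * t ^ 2) {Q : ℝ → ℝ → ℝ}
    (hQc : ∀ z, 0 < z → ContinuousAt (fun x => Q x z) z)
    (hQ0 : ∀ x y, t ≤ y → y ≤ x → 0 ≤ Q x y)
    (hQ : ∀ x y, t ≤ y → y < x → x ^ 2 + t ^ 2 ≤ 1 →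
      capProfile m t x - capProfile m t y ≤ (x ^ 2 - y ^ 2) * Q x y)
    {P : ℝ → Prop} (hP0 : P 0)
    (hP1 : ∀ x, t < x → x < 1 → 1 ≤ x ^ 2 + t ^ 2 → P (capProfile m t x / (2 * x ^ 2 - 1)))
    (hP2 : ∀ x y, t ≤ y → y ≤ x → t < x → x ^ 2 + y ^ 2 ≤ 1 →
      P (x ^ 2 * Q x y / (2 * x ^ 2 + y ^ 2 - 1))) :
    ∃ v, P v ∧ parallelSection a t ≤ ENNReal.ofReal (2 ^ (m + 1) / (m + 1).factorial * v) := by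
  obtain ⟨a', σ, h1, h2, h3, h4⟩ := exists_antitone_parallelSection_eq a
  rw [← h4]
  refine exists_bound_of_antitone (h3.trans ha) (fun i => ?_) h2 ?_ ht ht3 htm hQc hQ0 hQ hP0 hP1 hP2
  · rw [h1]; exact abs_nonneg _
  · rw [h1]
    exact lt_of_le_of_ne (abs_le_one_of_norm_eq_one ha _)
      fun h => hnc ((isCoordinateDirection_iff ha).2 ⟨_, h⟩)

/-! ### Dimension at least four. -/

theorem two_vertex_numerator_nonneg {t x y : ℝ} (ht : 0 < t) (hty : t ≤ y) (hyx : y ≤ x) :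
    0 ≤ x ^ 2 * y ^ 2 - 3 * t ^ 2 * x * y + t ^ 3 * (x + y) := by
  obtain ⟨r, rfl⟩ : ∃ r, y = t + r := ⟨y - t, by ring⟩
  obtain ⟨p, rfl⟩ : ∃ p, x = t + p := ⟨x - t, by ring⟩
  have hr : 0 ≤ r := by linarith
  have hp : 0 ≤ p := by linarith
  have : (t + p) ^ 2 * (t + r) ^ 2 - 3 * t ^ 2 * (t + p) * (t + r) + t ^ 3 * (t + p + (t + r)) =
    t ^ 2 * (p ^ 2 + p * r + r ^ 2) + 2 * t * p * r * (p + r) + p ^ 2 * r ^ 2 := by ring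
  rw [this]
  positivity

theorem capProfile_div_lt {t x : ℝ} (ht : 0 < t) (ht3 : 1 ≤ 3 * t ^ 2) (htx : t < x) (hx1 : x < 1)
    (hxt : 1 ≤ x ^ 2 + t ^ 2) (j : ℕ) :
    capProfile (j + 2) t x / (2 * x ^ 2 - 1) < (1 - t) ^ (j + 2 + 1) := by
  have hx0 : 0 < x := by linarith
  have hD : 0 < 2 * x ^ 2 - 1 := by nlinarith
  have h1 := four_dim_one_vertex_lt ht ht3 htx hx1 hxt
  have h2 : capProfile (j + 2) t x = ((x - t) / x) ^ j * ((x - t) ^ 3 / x ^ 2) := by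
    unfold capProfile
    rw [div_pow]
    field_simp
    ring
  have h3 : (x - t) / x ≤ 1 - t := by
    rw [div_le_iff₀ hx0]; nlinarith
  have h4 : 0 ≤ (x - t) / x := div_nonneg (by linarith) hx0.le
  have h5 : (x - t) ^ 3 / x ^ 2 < (1 - t) ^ 3 * (2 * x ^ 2 - 1) := by
    rw [div_lt_iff₀ (by positivity)]
    linarith
  rw [div_lt_iff₀ hD, h2]
  have h6 : 0 < (1 - t) ^ j := pow_pos (by linarith) j
  have h7 : 0 ≤ (x - t) ^ 3 / x ^ 2 := div_nonneg (pow_nonneg (by linarith) _) (by positivity)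
  calc _ ≤ (1 - t) ^ j * ((x - t) ^ 3 / x ^ 2) :=
        mul_le_mul_of_nonneg_right (pow_le_pow_left₀ h4 h3 j) h7
    _ < (1 - t) ^ j * ((1 - t) ^ 3 * (2 * x ^ 2 - 1)) := mul_lt_mul_of_pos_left h5 h6
    _ = _ := by ring

theorem parallelSection_lt_of_four_le (j : ℕ) {t : ℝ} (ht : 0 < t) (ht3 : 1 ≤ 3 * t ^ 2) (ht1 : t < 1)
    {a : EuclideanSpace ℝ (Fin (j + 4))} (ha : ‖a‖ = 1) (hnc : ¬ IsCoordinateDirection a) :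
    parallelSection a t <
      ENNReal.ofReal (2 ^ (j + 3) / (j + 3).factorial * (1 - t) ^ (j + 3)) := by
  have h1t : 0 < 1 - t := by linarith
  obtain ⟨v, hv, hle⟩ := exists_bound_of_not_isCoordinateDirection (m := j + 2) ha hnc ht ht3
    (by push_cast; nlinarith [mul_nonneg (Nat.cast_nonneg j : (0 : ℝ) ≤ j) (sq_nonneg t)])
    (Q := fun x y => (1 - t) ^ j *
      ((x ^ 2 * y ^ 2 - 3 * t ^ 2 * x * y + t ^ 3 * (x + y)) / (x ^ 2 * y ^ 2 * (x + y))))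
    (P := fun v => v < (1 - t) ^ (j + 3))
    (by
      intro z hz
      have : z ^ 2 * z ^ 2 * (z + z) ≠ 0 := by positivity
      fun_prop (disch := assumption))
    (by
      intro x y hty hyx
      have := two_vertex_numerator_nonneg ht hty hyx
      have hy : 0 < y := by linarith
      have hx : 0 < x := by linarith
      positivity)
    (by
      intro x y hty hyx hx
      have h := capProfile_sub_le_pow_mul ht ht3 hty hyx.le hx j
      rw [capProfile_two_sub (by linarith) (by linarith)] at h
      linarith)
    (by positivity)
    (fun x h1 h2 h3 => capProfile_div_lt ht ht3 h1 h2 h3 j)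
    (by
      intro x y hty hyx htx hxy
      have hy : 0 < y := by linarith
      have hx : 0 < x := by linarith
      have h := four_dim_two_vertex_lt ht ht3 hty hyx htx hxy
      have hD : 0 < 2 * x ^ 2 + y ^ 2 - 1 := by nlinarith
      rw [div_lt_iff₀ hD]
      have h6 : 0 < (1 - t) ^ j := by positivity
      have h7 : x ^ 2 * ((x ^ 2 * y ^ 2 - 3 * t ^ 2 * x * y + t ^ 3 * (x + y)) / (x ^ 2 * y ^ 2 * (x + y))) <
          (1 - t) ^ 3 * (2 * x ^ 2 + y ^ 2 - 1) := by
        have e : x ^ 2 * ((x ^ 2 * y ^ 2 - 3 * t ^ 2 * x * y + t ^ 3 * (x + y)) / (x ^ 2 * y ^ 2 * (x + y))) =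
          (x ^ 2 * y ^ 2 - 3 * t ^ 2 * x * y + t ^ 3 * (x + y)) / (y ^ 2 * (x + y)) := by
          field_simp
        rw [e, div_lt_iff₀ (by positivity)]
        linarith
      calc _ = (1 - t) ^ j * _ := by rw [mul_left_comm]
        _ < (1 - t) ^ j * _ := mul_lt_mul_of_pos_left h7 h6
        _ = _ := by ring)
  refine hle.trans_lt ((ENNReal.ofReal_lt_ofReal_iff (by positivity)).2 ?_)
  exact mul_lt_mul_of_pos_left hv (by positivity)

/-! ### Dimension three and the threshold. -/

theorem threshold_identity (t : ℝ) : √2 * (1 - t) ^ 2 - (1 - 2 * t ^ 2) =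
    (2 + √2) * ((t - (√2 - 1)) ^ 2 - (5 - 7 / √2)) := by
  have hS : √2 ^ 2 = 2 := Real.sq_sqrt (by norm_num)
  have h7 : 7 / √2 = 7 * √2 / 2 := by
    field_simp
    linarith
  rw [h7]
  linear_combination (2 * t - √2 - 7 / 2) * hS

/-- The hypothesis places `t` to the right of the vertex of the parabola, so only its larger root
matters. -/
theorem threshold_le_iff {t : ℝ} (ht : √2 - 1 ≤ t) :
    √2 - 1 + √(5 - 7 / √2) ≤ t ↔ 1 - 2 * t ^ 2 ≤ √2 * (1 - t) ^ 2 := by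
  have h := threshold_identity t
  have hp : 0 < 2 + √2 := by positivity
  rw [← le_sub_iff_add_le', Real.sqrt_le_left (by linarith)]
  constructor
  · intro h1
    have := mul_nonneg hp.le (sub_nonneg.2 h1)
    linarith
  · intro h1
    have h2 : 0 ≤ (2 + √2) * ((t - (√2 - 1)) ^ 2 - (5 - 7 / √2)) := by linarith
    linarith [nonneg_of_mul_nonneg_right h2 hp]

theorem threshold_gt : 0.6383 < √2 - 1 + √(5 - 7 / √2) := by
  have hS : √2 ^ 2 = 2 := Real.sq_sqrt (by norm_num)
  have h1 : √2 < 1.41422 := by nlinarith [Real.sqrt_nonneg 2]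
  have h2 : 1.41421 < √2 := by nlinarith [Real.sqrt_nonneg 2]
  by_contra! h
  have := (threshold_le_iff (by linarith)).1 h
  nlinarith

theorem threshold_lt : √2 - 1 + √(5 - 7 / √2) < 0.64 := by
  have hS : √2 ^ 2 = 2 := Real.sq_sqrt (by norm_num)
  have h1 : √2 < 1.41422 := by nlinarith [Real.sqrt_nonneg 2]
  have h2 : 1.41421 < √2 := by nlinarith [Real.sqrt_nonneg 2]
  have := (threshold_le_iff (t := 0.639) (by linarith)).2 (by nlinarith)
  linarith

theorem exists_bound_three {t : ℝ} (ht : 0.6383 ≤ t) (ht1 : t < 1) {P : ℝ → Prop}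
    (hP : ∀ v w, v ≤ w → P w → P v) (h1 : ∀ v, v < (1 - t) ^ 2 → P v)
    (h2 : P ((1 - 2 * t ^ 2) / √2)) {a : EuclideanSpace ℝ (Fin 3)}
    (ha : ‖a‖ = 1) (hnc : ¬ IsCoordinateDirection a) :
    ∃ v, P v ∧ parallelSection a t ≤ ENNReal.ofReal (2 ^ 2 / (2).factorial * v) := by
  have ht0 : 0 < t := by linarith
  have h1t : 0 < 1 - t := by linarith
  refine exists_bound_of_not_isCoordinateDirection (m := 1) ha hnc ht0 (by nlinarith)
    (by push_cast; nlinarith)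
    (Q := fun x y => (x * y - t ^ 2) / (x * y * (x + y))) (P := P) ?_ ?_ ?_ ?_ ?_ ?_
  · intro z hz
    have : z * z * (z + z) ≠ 0 := by positivity
    fun_prop (disch := assumption)
  · intro x y hty hyx
    have hy : 0 < y := by linarith
    have hx : 0 < x := by linarith
    refine div_nonneg ?_ (by positivity)
    nlinarith
  · intro x y hty hyx hx
    rw [capProfile_one_sub (by linarith) (by linarith)]
  · exact h1 0 (by positivity)
  · intro x htx hx1 hxt
    refine h1 _ ?_
    have hx0 : 0 < x := by linarith
    have hD : 0 < 2 * x ^ 2 - 1 := by nlinarith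
    have h := three_dim_one_vertex_lt ht htx hx1 hxt
    unfold capProfile
    rw [div_lt_iff₀ hD, pow_one, div_lt_iff₀ hx0, one_add_one_eq_two]
    linarith
  · intro x y hty hyx htx hxy
    refine hP _ _ ?_ h2
    have hy : 0 < y := by linarith
    have hx : 0 < x := by linarith
    have hD : 0 < 2 * x ^ 2 + y ^ 2 - 1 := by nlinarith
    have h := three_dim_two_vertex_le (t := t) (by nlinarith) hy hyx (by nlinarith) hD hxy
    have e : x ^ 2 * ((x * y - t ^ 2) / (x * y * (x + y))) / (2 * x ^ 2 + y ^ 2 - 1) =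
      x * (x * y - t ^ 2) / (y * (x + y) * (2 * x ^ 2 + y ^ 2 - 1)) := by
      field_simp
    rw [e, div_le_div_iff₀ (by positivity) (by positivity)]
    linarith

theorem parallelSection_three_lt {t : ℝ} (ht : √2 - 1 + √(5 - 7 / √2) < t) (ht1 : t < 1)
    {a : EuclideanSpace ℝ (Fin 3)} (ha : ‖a‖ = 1) (hnc : ¬ IsCoordinateDirection a) :
    parallelSection a t < ENNReal.ofReal (2 ^ 2 / (2).factorial * (1 - t) ^ 2) := by
  have h0 := threshold_gt
  have h1t : 0 < 1 - t := by linarith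
  have hS1 : √2 - 1 < 0.5 := by nlinarith [Real.sqrt_nonneg 2, Real.sq_sqrt (show (0 : ℝ) ≤ 2 by norm_num)]
  obtain ⟨v, hv, hle⟩ := exists_bound_three (h0.trans ht).le ht1 (P := fun v => v < (1 - t) ^ 2)
    (fun v w h h' => h.trans_lt h') (fun v h => h)
    (by
      rw [div_lt_iff₀ (by positivity)]
      have h2 := threshold_identity t
      have h3 : √(5 - 7 / √2) < t - (√2 - 1) := by linarith
      have h4 := (Real.sqrt_lt' (by linarith)).1 h3
      have h5 : 0 < (2 + √2) * ((t - (√2 - 1)) ^ 2 - (5 - 7 / √2)) :=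
        mul_pos (by positivity) (by linarith)
      linarith) ha hnc
  refine hle.trans_lt ((ENNReal.ofReal_lt_ofReal_iff (by positivity)).2 ?_)
  exact mul_lt_mul_of_pos_left hv (by positivity)

theorem parallelSection_three_le {t : ℝ} (ht : √2 - 1 + √(5 - 7 / √2) ≤ t) (ht1 : t < 1)
    {a : EuclideanSpace ℝ (Fin 3)} (ha : ‖a‖ = 1) (hnc : ¬ IsCoordinateDirection a) :
    parallelSection a t ≤ ENNReal.ofReal (2 ^ 2 / (2).factorial * (1 - t) ^ 2) := by
  have h0 := threshold_gt
  have hS1 : √2 - 1 < 0.5 := by nlinarith [Real.sqrt_nonneg 2, Real.sq_sqrt (show (0 : ℝ) ≤ 2 by norm_num)]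
  obtain ⟨v, hv, hle⟩ := exists_bound_three (h0.trans_le ht).le ht1 (P := fun v => v ≤ (1 - t) ^ 2)
    (fun v w h h' => h.trans h') (fun v h => h.le)
    (by
      rw [div_le_iff₀ (by positivity)]
      have := (threshold_le_iff (by linarith)).1 ht
      linarith) ha hnc
  exact hle.trans (ENNReal.ofReal_le_ofReal (mul_le_mul_of_nonneg_left hv (by positivity)))

theorem parallelSection_one_eq_zero {m : ℕ} {a : EuclideanSpace ℝ (Fin (m + 2))} (ha : ‖a‖ = 1) :
    parallelSection a 1 = 0 := by
  obtain ⟨a', σ, h1, h2, h3, h4⟩ := exists_antitone_parallelSection_eq a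
  rw [← h4]
  have hle : ∀ i, |a' i| ≤ 1 := abs_le_one_of_norm_eq_one (h3.trans ha)
  have hn : ∀ i, 0 ≤ a' i := fun i => by rw [h1]; exact abs_nonneg _
  have hsum := norm_sq_eq_add_sum (h3.trans ha)
  have hS : 0 ≤ ∑ i : Fin m, a' i.succ.succ ^ 2 := Finset.sum_nonneg fun i _ => sq_nonneg _
  have h10 : a' 1 ≤ a' 0 := h2 (Fin.zero_le _)
  have h00 : 0 < a' 0 := by
    by_contra hc
    have hz : ∀ i, a' i = 0 := fun i => le_antisymm ((h2 (Fin.zero_le i)).trans (not_lt.1 hc)) (hn i)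
    simp [hz] at hsum
  refine parallelSection_eq_zero a' (h3.trans ha) h00 hle (k := 0) ?_
  have e : (Fin.succ 0 : Fin (m + 2)) = 1 := rfl
  rw [e, abs_of_nonneg (hn 1)]
  nlinarith [hn 1]

theorem parallelSection_three_of_third_eq_zero {x y t : ℝ} (hy : 0 < y) (hyx : y < x) (hxy : x ^ 2 + y ^ 2 = 1)
    (ht : 0 ≤ t) (hty : t ≤ y) :
    parallelSection (!₂[x, y, 0] : EuclideanSpace ℝ (Fin 3)) t =
      ENNReal.ofReal (2 ^ 2 / (2).factorial * ((x * y - t ^ 2) / (x * y * (x + y)))) := by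
  have hn : ‖(!₂[x, y, 0] : EuclideanSpace ℝ (Fin 3))‖ = 1 := by
    rw [EuclideanSpace.norm_eq, Fin.sum_univ_three]
    simp [hxy]
  have e0 : (!₂[x, y, 0] : EuclideanSpace ℝ (Fin (1 + 2))) 0 = x := rfl
  have e1 : (!₂[x, y, 0] : EuclideanSpace ℝ (Fin (1 + 2))) 1 = y := rfl
  have e2 : ∀ i : Fin 1, (!₂[x, y, 0] : EuclideanSpace ℝ (Fin (1 + 2))) i.succ.succ = 0 := by
    intro i
    fin_cases i
    rfl
  rw [parallelSection_eq_slabMass (m := 1) _ hn (by rw [e1]; exact hy.le) (by rw [e0, e1]; exact hyx) ht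
    (fun i => by rw [e2, e1, abs_zero]; exact hy.le) (fun i => by rw [e2, abs_zero]; exact ht), e0, e1,
    slabMass_eq hty hy, slabMass_eq (hty.trans hyx.le) (hy.trans hyx)]
  congr 1
  have hv : ∀ z : ℝ, 0 < z → vertexFactor (fun i : Fin 1 => (!₂[x, y, 0] : EuclideanSpace ℝ (Fin (1 + 2))) i.succ.succ) z = 1 := by
    intro z hz
    simp only [vertexFactor]
    simp
    exact hz.ne'
  have hx : 0 < x := hy.trans hyx
  rw [hv x hx, hv y hy, mul_one, mul_one, ← mul_sub, capProfile_one_sub hx hy]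
  have : x ^ 2 - y ^ 2 ≠ 0 := by nlinarith
  norm_num [Nat.factorial]
  field_simp

/-- For `t ≤ 1/2` the direction `(√(1 - t²), t, 0)` works; for larger `t` a direction near the
diagonal does, perturbed because the explicit formula requires `y < x`. -/
theorem exists_three_gt {t : ℝ} (ht : 0 < t) (ht0 : t < √2 - 1 + √(5 - 7 / √2)) :
    ∃ a : EuclideanSpace ℝ (Fin 3), ‖a‖ = 1 ∧
      ENNReal.ofReal (2 ^ 2 / (2).factorial * (1 - t) ^ 2) < parallelSection a t := by
  suffices h : ∃ x y : ℝ, 0 < y ∧ y < x ∧ x ^ 2 + y ^ 2 = 1 ∧ t ≤ y ∧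
      (1 - t) ^ 2 < (x * y - t ^ 2) / (x * y * (x + y)) by
    obtain ⟨x, y, hy, hyx, hxy, hty, hlt⟩ := h
    refine ⟨!₂[x, y, 0], ?_, ?_⟩
    · rw [EuclideanSpace.norm_eq, Fin.sum_univ_three]
      simp [hxy]
    · rw [parallelSection_three_of_third_eq_zero hy hyx hxy ht.le hty]
      refine (ENNReal.ofReal_lt_ofReal_iff ?_).2 (mul_lt_mul_of_pos_left hlt (by positivity))
      exact mul_pos (by positivity) ((sq_nonneg _).trans_lt hlt)
  rcases le_or_gt t (1 / 2) with h | h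
  · obtain ⟨x, hx⟩ : ∃ x, x = √(1 - t ^ 2) := ⟨_, rfl⟩
    have hx2 : x ^ 2 = 1 - t ^ 2 := by rw [hx]; exact Real.sq_sqrt (by nlinarith)
    have hx0 : 0 < x := by rw [hx]; exact Real.sqrt_pos.2 (by nlinarith)
    -- Chord bound for `√(1 - s)` on `0 ≤ s ≤ 1/4`; `0.536` rounds up `4 - 2√3`.
    have hxl : 1 - 0.536 * t ^ 2 ≤ x := by
      rw [hx]
      refine Real.le_sqrt_of_sq_le ?_
      have : t ^ 2 ≤ 1 / 4 := by nlinarith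
      nlinarith [sq_nonneg t]
    have htx : t < x := by nlinarith
    refine ⟨x, t, ht, htx, by linarith, le_rfl, ?_⟩
    rw [lt_div_iff₀ (by positivity)]
    have h1 : 0 < 1 - t * (1 - t) ^ 2 := by
      have : (1 - t) ^ 2 ≤ 1 := by nlinarith
      nlinarith
    have h2 : 0 < t ^ 2 * (1.464 - 2.464 * t - 0.072 * t ^ 2 + 0.536 * t ^ 3) := by
      refine mul_pos (by positivity) ?_
      have : 0 < t ^ 3 := by positivity
      nlinarith
    have h3 := mul_le_mul_of_nonneg_right hxl h1.le
    have h4 : (1 - t) ^ 2 * (x * (x + t)) < x - t := by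
      have : x * (x + t) = 1 - t ^ 2 + x * t := by rw [← hx2]; ring
      rw [this]
      nlinarith
    have := mul_lt_mul_of_pos_left h4 ht
    linarith
  · have hS : √2 ^ 2 = 2 := Real.sq_sqrt (by norm_num)
    have hS1 : √2 - 1 < 0.5 := by nlinarith [Real.sqrt_nonneg 2]
    have hlt : √2 * (1 - t) ^ 2 < 1 - 2 * t ^ 2 := by
      by_contra! hc
      have := (threshold_le_iff (by linarith)).2 hc
      linarith
    have ht64 := ht0.trans threshold_lt
    obtain ⟨F, hF⟩ : ∃ F : ℝ → ℝ, F = fun ε => (√(1 / 2 + ε) * √(1 / 2 - ε) - t ^ 2) /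
      (√(1 / 2 + ε) * √(1 / 2 - ε) * (√(1 / 2 + ε) + √(1 / 2 - ε))) := ⟨_, rfl⟩
    have hh : √(1 / 2) = √2 / 2 := by
      rw [Real.sqrt_eq_iff_mul_self_eq_of_pos (by positivity)]
      nlinarith
    have hF0 : (1 - t) ^ 2 < F 0 := by
      rw [hF]
      simp only [add_zero, sub_zero]
      rw [hh, lt_div_iff₀ (by positivity)]
      have e1 : √2 / 2 * (√2 / 2) = 1 / 2 := by linarith
      rw [e1]
      linarith
    have hFc : ContinuousAt F 0 := by
      rw [hF]
      have hne : √(1 / 2 + (0 : ℝ)) * √(1 / 2 - 0) * (√(1 / 2 + 0) + √(1 / 2 - 0)) ≠ 0 := by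
        simp only [add_zero, sub_zero]
        rw [hh]
        positivity
      fun_prop (disch := assumption)
    have hev1 : ∀ᶠ ε in nhds (0 : ℝ), (1 - t) ^ 2 < F ε := continuousAt_const.eventually_lt hFc hF0
    -- Ensures `t² < 0.64² < 0.42 < 1/2 - ε`, hence `t ≤ y`.
    have hev2 : ∀ᶠ ε in nhds (0 : ℝ), ε < 0.08 := gt_mem_nhds (by norm_num)
    obtain ⟨ε, ⟨h1, h2⟩, h3⟩ := (((hev1.and hev2).filter_mono
      (nhdsWithin_le_nhds (s := Set.Ioi (0 : ℝ)))).and self_mem_nhdsWithin).exists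
    have hε : 0 < ε := h3
    rw [hF] at h1
    refine ⟨√(1 / 2 + ε), √(1 / 2 - ε), Real.sqrt_pos.2 (by linarith),
      Real.sqrt_lt_sqrt (by linarith) (by linarith), ?_, ?_, h1⟩
    · rw [Real.sq_sqrt (by linarith), Real.sq_sqrt (by linarith)]
      ring
    · refine Real.le_sqrt_of_sq_le ?_
      nlinarith

/-! ### Assembly; `t = 1` is separate, as all sections are then null. -/

theorem theorem1 :
    (∀ (n : ℕ) (hn : 4 ≤ n) (t : ℝ), 1 / √3 ≤ t → t ≤ 1 →
      (∀ a : EuclideanSpace ℝ (Fin n), ‖a‖ = 1 →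
        parallelSection a t ≤
          parallelSection (EuclideanSpace.single (⟨0, by omega⟩ : Fin n) (1 : ℝ)) t) ∧
      parallelSection (EuclideanSpace.single (⟨0, by omega⟩ : Fin n) (1 : ℝ)) t =
        ENNReal.ofReal (2 ^ (n - 1) / (Nat.factorial (n - 1) : ℝ) * (1 - t) ^ (n - 1)) ∧
      (t < 1 → ∀ a : EuclideanSpace ℝ (Fin n), ‖a‖ = 1 →
        (parallelSection a t =
            parallelSection (EuclideanSpace.single (⟨0, by omega⟩ : Fin n) (1 : ℝ)) t ↔
          IsCoordinateDirection a))) ∧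
    (∀ t : ℝ, 0 < t → t ≤ 1 →
      ((∀ a : EuclideanSpace ℝ (Fin 3), ‖a‖ = 1 →
          parallelSection a t ≤ parallelSection (EuclideanSpace.single (0 : Fin 3) (1 : ℝ)) t) ↔
        √2 - 1 + √(5 - 7 / √2) ≤ t) ∧
      parallelSection (EuclideanSpace.single (0 : Fin 3) (1 : ℝ)) t =
        ENNReal.ofReal (2 ^ 2 / (Nat.factorial 2 : ℝ) * (1 - t) ^ 2) ∧
      (√2 - 1 + √(5 - 7 / √2) < t → t < 1 →
        ∀ a : EuclideanSpace ℝ (Fin 3), ‖a‖ = 1 →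
          (parallelSection a t =
              parallelSection (EuclideanSpace.single (0 : Fin 3) (1 : ℝ)) t ↔
            IsCoordinateDirection a))) := by
  constructor
  · intro n hn t ht ht1
    obtain ⟨j, rfl⟩ := Nat.exists_eq_add_of_le' hn
    have hS : √3 ^ 2 = 3 := Real.sq_sqrt (by norm_num)
    have ht0 : 0 < t := lt_of_lt_of_le (by positivity) ht
    have ht3 : 1 ≤ 3 * t ^ 2 := by
      have h1 := pow_le_pow_left₀ (by positivity) ht 2
      rw [div_pow, hS] at h1
      linarith
    have he := parallelSection_single_zero (j + 2) ht0.le ht1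
    change (∀ a : EuclideanSpace ℝ (Fin (j + 4)), ‖a‖ = 1 → parallelSection a t ≤
          parallelSection (EuclideanSpace.single (0 : Fin (j + 2 + 2)) (1 : ℝ)) t) ∧
      parallelSection (EuclideanSpace.single (0 : Fin (j + 2 + 2)) (1 : ℝ)) t =
        ENNReal.ofReal (2 ^ (j + 3) / (Nat.factorial (j + 3) : ℝ) * (1 - t) ^ (j + 3)) ∧
      (t < 1 → ∀ a : EuclideanSpace ℝ (Fin (j + 4)), ‖a‖ = 1 →
        (parallelSection a t =
            parallelSection (EuclideanSpace.single (0 : Fin (j + 2 + 2)) (1 : ℝ)) t ↔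
          IsCoordinateDirection a))
    refine ⟨fun a ha => ?_, he, fun hlt a ha => ⟨fun h => ?_, fun h => ?_⟩⟩
    · rcases ht1.lt_or_eq with hlt | rfl
      · by_cases hc : IsCoordinateDirection a
        · exact (parallelSection_of_isCoordinateDirection (m := j + 2) ha hc t).le
        · rw [he]
          exact (parallelSection_lt_of_four_le j ht0 ht3 hlt ha hc).le
      · rw [parallelSection_one_eq_zero (m := j + 2) ha]
        exact zero_le
    · by_contra hc
      have h1 := parallelSection_lt_of_four_le j ht0 ht3 hlt ha hc
      rw [h, he] at h1
      exact lt_irrefl _ h1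
    · exact parallelSection_of_isCoordinateDirection (m := j + 2) ha h t
  · intro t ht0 ht1
    have he : parallelSection (EuclideanSpace.single (0 : Fin 3) (1 : ℝ)) t =
        ENNReal.ofReal (2 ^ 2 / (Nat.factorial 2 : ℝ) * (1 - t) ^ 2) :=
      parallelSection_single_zero 1 ht0.le ht1
    refine ⟨⟨fun h => ?_, fun h a ha => ?_⟩, he, fun h hlt a ha => ⟨fun h' => ?_, fun h' => ?_⟩⟩
    · by_contra! hc
      obtain ⟨a, ha, hlt⟩ := exists_three_gt ht0 hc
      rw [← he] at hlt
      exact lt_irrefl _ (hlt.trans_le (h a ha))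
    · rcases ht1.lt_or_eq with hlt | rfl
      · by_cases hc : IsCoordinateDirection a
        · exact (parallelSection_of_isCoordinateDirection (m := 1) ha hc t).le
        · rw [he]
          exact parallelSection_three_le h hlt ha hc
      · rw [parallelSection_one_eq_zero (m := 1) ha]
        exact zero_le
    · by_contra hc
      have h1 := parallelSection_three_lt h hlt ha hc
      rw [h', he] at h1
      exact lt_irrefl _ h1
    · exact parallelSection_of_isCoordinateDirection (m := 1) ha h' t
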